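/- **Setting.** Fix a free ultrafilter $\mathcal F$ on $\mathbb N$. Let $G^{\nu}$ be a wconnected transfinite wgraph (walk-based transfinite graph) of rank $\nu\le\omega$ (a natural number, $\vec\omega$ or $\omega$, where $n<\vec\omega<\omega$ for every natural number $n$). Let $d(x,y)$ be the wdistance of two wnodes: the minimum of the ordinal lengths of the two-ended walks in $G^{\nu}$ that terminate at $x$ and $y$. Here a walk terminates at every wnode that embraces or is embraced by its terminal wnode; a branch has length $1$, a one-ended $\alpha$-walk has length $\omega^{\alpha+1}$ ($\omega^{\omega}$ if $\alpha=\vec\omega$), an endless one twice that, and the length of a two-ended walk is the natural sum of the lengths of the walks (or branches) between its consecutive nodes. Let $\rho\le\nu$ be a natural number or $\omega$, and let $S^{\rho}$ be a $\rho$-wsection of $G^{\nu}$, that is, a maximal part of the $\rho$-wgraph of $G^{\nu}$ any two wnodes of which (of ranks at most $\rho$) are the terminal wnodes of a two-ended walk of rank at most $\rho$. The hypernodes $\mathbf x=[x_n]$ of the enlargement ${}^{*}S^{\rho}$ are the classes, modulo $\mathcal F$, of sequences of wnodes of $S^{\rho}$ of one common rank; its hyperbranches are the classes of sequences of branches of $S^{\rho}$.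 Two hypernodes $[x_n]$, $[y_n]$ are $\rho$-limitedly distant if $\{n: d(x_n,y_n)\le\omega^{\rho}\cdot\mu\}\in\mathcal F$ for some natural number $\mu$. A $\rho$-galaxy consists of all the hypernodes in one class of this equivalence relation together with all hyperbranches whose incident $0$-hypernodes are in that class. The principal $\rho$-galaxy $\Gamma_0^{\rho}$ is the one whose hypernodes are $\rho$-limitedly distant from a standard hypernode $[\langle x,x,x,\dots\rangle]$ of ${}^{*}S^{\rho}$. A $\rho$-galaxy $\Gamma_a$ is *closer to $\Gamma_0^{\rho}$ than is* a $\rho$-galaxy $\Gamma_b$ if there are hypernodes $[y_n]$ in $\Gamma_a$, $[z_n]$ in $\Gamma_b$ and $[x_n]$ in $\Gamma_0^{\rho}$, of ranks other than $\vec\omega$, such that for every natural number $m$ $$\{n:\ d(z_n,x_n)-d(y_n,x_n)\ \ge\ \omega^{\rho}\cdot m\}\in\mathcal F,$$ where $\alpha-\beta\ge\gamma$ means $\alpha\ge\beta\oplus\gamma$ with the natural sum $\oplus$ of ordinals. **Theorem 5.2.** Suppose that ${}^{*}S^{\rho}$ has a hypernode that is not in its principal $\rho$-galaxy $\Gamma_0^{\rho}$.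 Then the set of $\rho$-galaxies of ${}^{*}S^{\rho}$ is partially ordered according to their closeness to $\Gamma_0^{\rho}$: the relation "$\Gamma_a$ is closer to $\Gamma_0^{\rho}$ than is $\Gamma_b$" is irreflexive and transitive, and the relation "$\Gamma_a=\Gamma_b$, or $\Gamma_a$ is closer to $\Gamma_0^{\rho}$ than is $\Gamma_b$" is reflexive, antisymmetric and transitive. -/

import Mathlib

open Filter

universe u

/-! ### Ranks and ordinals -/

/-- The ranks `0 < 1 < 2 < ... < arrow ω < ω` of wnodes, walks and wgraphs. A natural number `n` is
the rank `n`, the top of `ℕ∞` is the rank "arrow `ω`", which precedes `ω`, and the top of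
`WithTop ℕ∞` is the rank `ω`. -/
abbrev WRank : Type := WithTop ℕ∞

/-- The rank "arrow `ω`": larger than every natural number and smaller than the rank `ω`. -/
def WRank.arrow : WRank := ((⊤ : ℕ∞) : WRank)

/-- The rank of the wnodes whose elements are wtips of rank `r`: it is `n + 1` for the natural
number `n`, and `ω` for arrow `ω`. (It is used only for `r < ω`.) -/
noncomputable def WRank.next (r : WRank) : WRank := open Classical in
  if r = WRank.arrow then ⊤ else r + 1

/-- The exponent `ρ` of `ω ^ ρ`, for a rank `ρ` that is a natural number or `ω`.
(The value at arrow `ω` is not used.) -/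
noncomputable def WRank.exponent : WRank → Ordinal.{0}
  | ⊤ => Ordinal.omega0
  | ((⊤ : ℕ∞) : WithTop ℕ∞) => Ordinal.omega0
  | (((n : ℕ) : ℕ∞) : WithTop ℕ∞) => (n : Ordinal)

/-- The exponent `e` for which a one-ended walk of rank `r` has the length `ω ^ e`: it is `n + 1`
for the natural number `n`, it is `ω` for arrow `ω`, and `ω + 1` for `ω`. -/
noncomputable def WRank.tipExponent : WRank → Ordinal.{0}
  | ⊤ => Ordinal.omega0 + 1
  | ((⊤ : ℕ∞) : WithTop ℕ∞) => Ordinal.omega0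
  | (((n : ℕ) : ℕ∞) : WithTop ℕ∞) => (n : Ordinal) + 1

/-- The natural (Hessenberg) sum of two ordinals: the least ordinal larger than all `a' ⊕ b` with
`a' < a` and all `a ⊕ b'` with `b' < b`. -/
noncomputable def natAdd (a b : Ordinal.{0}) : Ordinal.{0} :=
  max (⨆ x : Set.Iio a, Order.succ (natAdd x.1 b)) (⨆ x : Set.Iio b, Order.succ (natAdd a x.1))
termination_by (a, b)
decreasing_by
  · exact Prod.Lex.left _ _ x.2
  · exact Prod.Lex.right _ x.2

/-- The natural sum of the `k` ordinals `f a`, `f (a + 1)`, ..., `f (a + k - 1)`. -/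
noncomputable def natSum (f : ℤ → Ordinal.{0}) (a : ℤ) : ℕ → Ordinal.{0}
  | 0 => 0
  | k + 1 => natAdd (natSum f a k) (f (a + k))

/-! ### Walks as sequences

The terms of a walk are indexed by an interval of integers: `lo` is its least index, or `none` if
the walk extends infinitely to the left, and `hi` is its largest index, or `none` if the walk
extends infinitely to the right. The node `x m` exists for `lo ≤ m ≤ hi`, and the piece `P m`
between `x m` and `x (m + 1)` exists for `lo ≤ m < hi`. -/

/-- `m` is the index of a node. -/
def NodeIdx (lo hi : Option ℤ) (m : ℤ) : Prop := (∀ a ∈ lo, a ≤ m) ∧ ∀ b ∈ hi, m ≤ b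

/-- `m` is the index of a piece. -/
def PieceIdx (lo hi : Option ℤ) (m : ℤ) : Prop := (∀ a ∈ lo, a ≤ m) ∧ ∀ b ∈ hi, m < b

/-- `m` is the index of a nonterminal node. -/
def InnerIdx (lo hi : Option ℤ) (m : ℤ) : Prop := (∀ a ∈ lo, a < m) ∧ ∀ b ∈ hi, m < b

/-- Alternating sequences `⟨..., x m, P m, x (m + 1), P (m + 1), ...⟩` of nodes and pieces, labelled
by a rank. Each piece is a branch, or again such a sequence. The conditions that make such a
sequence a walk in a wgraph are imposed by `PreWGraph.IsWalk`. Values of `x` and `P` outside of the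
index interval are irrelevant. -/
inductive WSeq (X : Type u) : Type u
  | branch (b : Sym2 X) : WSeq X
  | seq (r : WRank) (lo hi : Option ℤ) (x : ℤ → X) (P : ℤ → WSeq X) : WSeq X

namespace WSeq

variable {X : Type u}

/-- The rank of a walk. -/
def rank : WSeq X → WRank
  | branch _ => 0
  | seq r _ _ _ _ => r

/-- The walk has at least one piece. -/
def Nontrivial : WSeq X → Prop
  | branch _ => False
  | seq _ lo hi _ _ => ∃ m, PieceIdx lo hi m

/-- The walk starts at a first node and extends infinitely to the right. -/
def OneEnded : WSeq X → Prop
  | seq _ (some _) none _ _ => True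
  | _ => False

/-- The walk traversed in the opposite direction. -/
def reverse : WSeq X → WSeq X
  | branch b => branch b
  | seq r lo hi x P =>
      seq r (hi.map Neg.neg) (lo.map Neg.neg) (fun m => x (-m)) (fun m => reverse (P (-1 - m)))

/-- Two sequences are the same: they have the same rank, nodes and pieces, up to a shift of the
indices and irrelevant values. -/
inductive Same : WSeq X → WSeq X → Prop
  | branch (b : Sym2 X) : Same (branch b) (branch b)
  | seq {r : WRank} {lo hi lo' hi' : Option ℤ} {x x' : ℤ → X} {P P' : ℤ → WSeq X} (k : ℤ)
      (hlo : lo' = lo.map (· + k)) (hhi : hi' = hi.map (· + k))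
      (hx : ∀ m, NodeIdx lo hi m → x m = x' (m + k))
      (hP : ∀ m, PieceIdx lo hi m → Same (P m) (P' (m + k))) :
      Same (seq r lo hi x P) (seq r lo' hi' x' P')

/-- Two walks that extend infinitely to the right are equivalent if they are eventually identical.
The equivalence classes of one-ended walks are the wtips. -/
def TailEquiv : WSeq X → WSeq X → Prop
  | seq r _ none x P, seq r' _ none x' P' =>
      r = r' ∧ ∃ N k : ℤ, ∀ m ≥ N, x m = x' (m + k) ∧ Same (P m) (P' (m + k))
  | _, _ => False

/-- The length of a walk. A branch has length `1`; the length of a two-ended walk is the natural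
sum of the lengths of its pieces; a one-ended walk of rank `r` has length `ω ^ (r + 1)`
and an endless one has length `ω ^ (r + 1) * 2` (and `ω ^ ω`, `ω ^ ω * 2` for `r` = arrow `ω`). -/
noncomputable def length : WSeq X → Ordinal.{0}
  | branch _ => 1
  | seq _ (some a) (some b) _ P => natSum (fun m => length (P m)) a (b - a).toNat
  | seq r none none _ _ => Ordinal.omega0 ^ r.tipExponent * 2
  | seq r _ _ _ _ => Ordinal.omega0 ^ r.tipExponent

end WSeq

/-! ### Wgraphs -/

/-- The data of a transfinite wgraph: the wnodes of all ranks, the branches, the wnodes that are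
elements of other wnodes, and the wtips (given by their representative one-ended walks) that are
elements of wnodes. -/
structure PreWGraph (X : Type u) where
  /-- the rank of a wnode -/
  rank : X → WRank
  /-- the branches -/
  branches : Set (Sym2 X)
  /-- `elem y x`: the wnode `y` is an element of the wnode `x` -/
  elem : X → X → Prop
  /-- `tip x W`: the wtip represented by the one-ended walk `W` is an element of the wnode `x` -/
  tip : X → WSeq X → Prop

namespace PreWGraph

variable {X : Type u} (G : PreWGraph X)

/-- The wnode `x` embraces the wnode `y`: it is `y`, or has `y` as an element, or as an element of
an element, and so on. -/
def Embraces (x y : X) : Prop := Relation.ReflTransGen G.elem y x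

/-- One of the two wnodes embraces the other. -/
def Linked (x y : X) : Prop := G.Embraces x y ∨ G.Embraces y x

/-- The walk extends infinitely to the right, and the wtip that it traverses there is an element
of the wnode `y`. -/
def RightTip (y : X) : WSeq X → Prop
  | .seq r lo none x P => ∃ k, NodeIdx lo none k ∧ G.tip y (.seq r (some k) none x P)
  | _ => False

/-- The walk extends infinitely to the left, and the wtip that it traverses there is an element
of the wnode `y`. -/
def LeftTip (y : X) (W : WSeq X) : Prop := G.RightTip y W.reverse

/-- On its right the walk reaches the wnode `z`: it terminates there at a wnode that embraces `z` or
is embraced by `z`, or it traverses there a wtip that is an element of such a wnode. -/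
def RightReach (z : X) : WSeq X → Prop
  | .branch _ => False
  | .seq _ _ (some b) x _ => G.Linked (x b) z
  | .seq r lo none x P => ∃ y, G.Linked y z ∧ G.RightTip y (.seq r lo none x P)

/-- On its left the walk reaches the wnode `z`. -/
def LeftReach (z : X) (W : WSeq X) : Prop := G.RightReach z W.reverse

/-- The shape of a walk of rank arrow `ω`. It is one-ended or endless, and, in the
direction of each infinite end, the ranks of its wnodes strictly increase, each piece having
a smaller rank than the wnode to which it leads. In one of its pieces `P p` (the first or last one
if the walk is one-ended) only the rank being natural is required. -/
def ArrowShape (lo hi : Option ℤ) (x : ℤ → X) (P : ℤ → WSeq X) : Prop :=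
  (lo = none ∨ hi = none) ∧
  ∃ p : ℤ, (∀ a ∈ lo, p ≤ a) ∧ (∀ b ∈ hi, b ≤ p + 1) ∧
    ∀ m, PieceIdx lo hi m →
      (p < m → G.rank (x m) < G.rank (x (m + 1)) ∧ (P m).rank < G.rank (x (m + 1))) ∧
      (m < p → G.rank (x (m + 1)) < G.rank (x m) ∧ (P m).rank < G.rank (x m))

open Classical in
/-- The sequence is a walk of its rank `r` (`r`-walk).
A `0`-walk is an alternating sequence of `0`-nodes and branches, each branch being incident to the
two `0`-nodes next to it. For `r > 0`, the pieces of an `r`-walk are nontrivial walks of ranks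
less than `r` that reach the wnodes next to them, and every nonterminal wnode of an `r`-walk is
reached by at least one of the two pieces next to it through a wtip that is an element of that
wnode. The nonterminal wnodes of an `r`-walk have rank `r`, unless `r` is arrow `ω`, when they have
natural-number ranks as described by `ArrowShape`. Terminal wnodes have ranks no larger than `r`. -/
def IsWalk : WSeq X → Prop
  | .branch _ => False
  | .seq r lo hi x P =>
      (∀ a ∈ lo, ∀ b ∈ hi, a ≤ b) ∧
      (∀ m, NodeIdx lo hi m → G.rank (x m) ≤ r) ∧
      if r = 0 then
        ∀ m, PieceIdx lo hi m →
          P m = .branch s(x m, x (m + 1)) ∧ s(x m, x (m + 1)) ∈ G.branches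
      else
        (∀ m, PieceIdx lo hi m →
          IsWalk (P m) ∧ (P m).Nontrivial ∧ (P m).rank < r ∧
            G.LeftReach (x m) (P m) ∧ G.RightReach (x (m + 1)) (P m)) ∧
        (∀ m, InnerIdx lo hi m → G.RightTip (x m) (P (m - 1)) ∨ G.LeftTip (x m) (P m)) ∧
        if r = WRank.arrow then G.ArrowShape lo hi x P
        else ∀ m, InnerIdx lo hi m → G.rank (x m) = r

/-- `W` is a two-ended walk that terminates at the wnodes `x` and `y`. A walk terminates at
all the wnodes that embrace, or are embraced by, its terminal wnodes. -/
def IsWalkBetween (x y : X) (W : WSeq X) : Prop :=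
  G.IsWalk W ∧ ∃ (r : WRank) (a b : ℤ) (z : ℤ → X) (P : ℤ → WSeq X),
    W = .seq r (some a) (some b) z P ∧ G.Linked (z a) x ∧ G.Linked (z b) y

/-- The wdistance: the minimum of the lengths of the two-ended walks that terminate at `x`, `y`. -/
noncomputable def wdist (x y : X) : Ordinal.{0} :=
  sInf {l | ∃ W, G.IsWalkBetween x y W ∧ l = W.length}

/-- The wnodes `x` and `y` are `ρ`-wconnected: there is a two-ended `α`-walk with `α ≤ ρ` that
terminates at them. -/
def WConnectedAt (ρ : WRank) (x y : X) : Prop := ∃ W, G.IsWalkBetween x y W ∧ W.rank ≤ ρ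

/-- Infinite sequences of wnodes, each one an element of the next, that start at a wnode without
such an element. -/
def IsNest (s : ℕ → X) : Prop := (∀ k, G.elem (s k) (s (k + 1))) ∧ ∀ y, ¬ G.elem y (s 0)

end PreWGraph

/-- A transfinite wgraph of rank `ν`, where `ν` is a natural number, arrow `ω`, or `ω`. -/
structure WGraph (X : Type u) (ν : WRank) extends PreWGraph X where
  rank_le : ∀ x, rank x ≤ ν
  /-- there are wnodes of every rank up to `ν`, except possibly for the rank arrow `ω` -/
  exists_rank : ∀ r ≤ ν, r ≠ WRank.arrow → ∃ x, rank x = r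
  /-- a branch is a two-element set of `0`-nodes -/
  branch_ends : ∀ b ∈ branches, ¬ b.IsDiag ∧ ∀ x ∈ b, rank x = 0
  /-- the wtips in wnodes are represented by one-ended walks; those of rank `r` occur only in
  wnodes of the next rank -/
  tip_spec : ∀ x W, tip x W →
    toPreWGraph.IsWalk W ∧ W.OneEnded ∧ rank x = W.rank.next
  /-- membership depends only on the wtip, not on its representative -/
  tip_congr : ∀ x W W', toPreWGraph.IsWalk W' → W'.OneEnded → W.TailEquiv W' →
    tip x W → tip x W'
  /-- the wtips of each rank less than `ν` are partitioned by the wnodes of the next rank -/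
  tip_partition : ∀ W, toPreWGraph.IsWalk W → W.OneEnded → W.rank < ν → ∃! x, tip x W
  /-- every wnode of a rank other than `0` and arrow `ω` has at least one wtip -/
  tip_nonempty : ∀ x, rank x ≠ 0 → rank x ≠ WRank.arrow → ∃ W, tip x W
  /-- the wnodes that are elements of a wnode have smaller ranks -/
  elem_rank : ∀ x y, elem y x → rank y < rank x
  /-- a wnode has at most one wnode as an element, unless its rank is arrow `ω` -/
  elem_unique : ∀ x y y', rank x ≠ WRank.arrow → elem y x → elem y' x → y = y'
  /-- different wnodes do not share such an element -/
  elem_disjoint : ∀ x x' y, rank x ≠ WRank.arrow → rank x' ≠ WRank.arrow →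
    elem y x → elem y x' → x = x'
  /-- a wnode of rank arrow `ω` is an infinite nested sequence of wnodes -/
  arrow_spec : ∀ z, rank z = WRank.arrow →
    ∃ s, toPreWGraph.IsNest s ∧ ∀ y, elem y z ↔ ∃ k, y = s k
  /-- every infinite nested sequence of wnodes is a wnode of rank arrow `ω` -/
  arrow_complete : ∀ s, toPreWGraph.IsNest s →
    ∃! z, rank z = WRank.arrow ∧ ∀ k, elem (s k) z

namespace WGraph

variable {X : Type u} {ν : WRank} (G : WGraph X ν)

/-- The wgraph is wconnected. -/
def WConnected : Prop := ∀ x y, ∃ W, G.IsWalkBetween x y W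

/-- `S` is the set of all wnodes of a `ρ`-wsection: a maximal set of wnodes of ranks no larger
than `ρ` any two of which are `ρ`-wconnected. (The branches of the `ρ`-wsection are the
branches whose `0`-nodes are in `S`.) -/
def IsWSection (ρ : WRank) (S : Set X) : Prop :=
  Maximal (fun N : Set X => (∀ x ∈ N, G.rank x ≤ ρ) ∧
    ∀ x ∈ N, ∀ y ∈ N, G.WConnectedAt ρ x y) S

/-! ### Enlargements -/

/-- The wnodes of rank `γ` in `S`. -/
def NodesOfRank (S : Set X) (γ : WRank) : Type u := {x : X // x ∈ S ∧ G.rank x = γ}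

/-- The branches with both ends in `S`. -/
def BranchesIn (S : Set X) : Type u := {b : Sym2 X // b ∈ G.branches ∧ ∀ x ∈ b, x ∈ S}

variable (F : Ultrafilter ℕ) (S : Set X)

/-- The hypernodes in the enlargement of the wsection `S`: a rank `γ` with an equivalence class
of sequences of wnodes of rank `γ`, modulo the ultrafilter. -/
def Hypernode : Type u := Σ γ : WRank, Germ (F : Filter ℕ) (G.NodesOfRank S γ)

/-- The hyperbranches in the enlargement of the wsection `S`. -/
def Hyperbranch : Type u := Germ (F : Filter ℕ) (G.BranchesIn S)

variable {F S}

/-- The rank of a hypernode. -/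
def Hypernode.rank {G : WGraph X ν} (x : G.Hypernode F S) : WRank := x.1

/-- The standard hypernode `[⟨x, x, x, ...⟩]`. -/
def standard (x : S) : G.Hypernode F S :=
  ⟨G.rank x, Germ.const ⟨x.1, x.2, rfl⟩⟩

/-- The hyperdistance `[d (x n, y n)]` between two hypernodes, a hyperordinal. -/
noncomputable def hyperdist (x y : G.Hypernode F S) : Germ (F : Filter ℕ) Ordinal.{0} :=
  Germ.map₂ (fun x y => G.wdist x.1 y.1) x.2 y.2

/-- The standard hyperordinal `ω ^ ρ * m`. -/
noncomputable def unitMul (F : Ultrafilter ℕ) (ρ : WRank) (m : ℕ) :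
    Germ (F : Filter ℕ) Ordinal.{0} :=
  Germ.const (Ordinal.omega0 ^ ρ.exponent * m)

/-- The hypernodes `x` and `y` are `ρ`-limitedly distant. -/
def LimitedlyDistant (ρ : WRank) (x y : G.Hypernode F S) : Prop :=
  ∃ μ : ℕ, G.hyperdist x y ≤ unitMul F ρ μ

/-- The hypernode `x` of rank `0` is incident to the hyperbranch `b`. -/
def Incident (x : G.Hypernode F S) (b : G.Hyperbranch F S) : Prop :=
  x.rank = 0 ∧ Germ.LiftRel (fun x b => x.1 ∈ b.1) x.2 b

variable (F S)

/-- Parts of the enlargement of `S`: a set of hypernodes and a set of hyperbranches. -/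
@[ext] structure EnlargementPart where
  /-- the hypernodes of the part -/
  hypernodes : Set (G.Hypernode F S)
  /-- the hyperbranches of the part -/
  hyperbranches : Set (G.Hyperbranch F S)

variable {F S}

/-- The part induced by a set `N` of hypernodes: along with `N` it has the
hyperbranches whose incident `0`-hypernodes are in `N`. -/
def induced (N : Set (G.Hypernode F S)) : G.EnlargementPart F S where
  hypernodes := N
  hyperbranches := {b | ∀ x, G.Incident x b → x ∈ N}

variable (F S)

/-- The `ρ`-galaxies of the enlargement of `S`: the parts induced by the nodal `ρ`-galaxies, that
is, by the classes of hypernodes that are `ρ`-limitedly distant from each other. -/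
def Galaxy (ρ : WRank) : Type u :=
  {Γ : G.EnlargementPart F S // ∃ x, Γ = G.induced {y | G.LimitedlyDistant ρ x y}}

/-- The principal `ρ`-galaxy: its hypernodes are those that are `ρ`-limitedly distant from a
standard hypernode. -/
def principalGalaxy (ρ : WRank) : G.EnlargementPart F S :=
  G.induced {y | ∃ x : S, G.LimitedlyDistant ρ (G.standard x) y}

variable {F S}

/-- `Γa` is closer to the principal `ρ`-galaxy than is `Γb`: there are hypernodes `y` in `Γa`, `z` in
`Γb` and `x` in the principal `ρ`-galaxy, of ranks other than arrow `ω`, such that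
`d (z, x) - d (y, x) ≥ ω ^ ρ * m` for every natural number `m`, that is,
`d (y, x) ⊕ ω ^ ρ * m ≤ d (z, x)` with the natural sum of (hyper)ordinals. -/
def Closer {ρ : WRank} (Γa Γb : G.Galaxy F S ρ) : Prop :=
  ∃ y ∈ Γa.1.hypernodes, ∃ z ∈ Γb.1.hypernodes, ∃ x ∈ (G.principalGalaxy F S ρ).hypernodes,
    x.rank ≠ WRank.arrow ∧ y.rank ≠ WRank.arrow ∧ z.rank ≠ WRank.arrow ∧
    ∀ m : ℕ, Germ.map₂ natAdd (G.hyperdist y x) (unitMul F ρ m) ≤ G.hyperdist z x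

end WGraph

/-! ### Natural sums -/

/-! The proof rests on a triangle inequality with a fixed error: for wnodes of a `ρ`-wsection, `d
(x, z) ≤ d (x, y) ⊕ d (y, z) ⊕ slack ρ`, where `slack ρ < ω ^ (ρ + 1)` (`wdist_triangle`). Ordinals
below `ω ^ (ρ + 1)` are closed under the natural sum (`natAdd_lt_omega0_opow`), and they are exactly
those below some `ω ^ ρ * m`. Being limitedly distant is therefore transitive, and replacing a
hypernode by another one of the same galaxy alters distances by an amount that the gap in `Closer`
absorbs. Since the natural sum is commutative, associative and cancellative, irreflexivity
(`not_closer_self`) and transitivity (`Closer.trans`) follow as for reals with bounded errors; the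
partial order is then formal.

The error term appears because walks cannot simply be concatenated: for `r` other than `0` and arrow
`ω`, a nonterminal wnode of an `r`-walk must have rank `r` and contain a wtip traversed by an
adjacent piece, and the place where two walks meet need not be such a wnode. `Bridging` says that
the two pieces that meet can be exchanged for at most three pieces, each of length at most `ω ^ ρ *
2`. For natural ranks it is proved by induction: either one of the pieces traverses a wtip of the
preceding rank at the junction, whose wnode can serve as the nonterminal wnode, or the two pieces
compose to a single walk of the preceding rank, by bridging in that rank (`bridging_nat`).

For rank `ω` the pieces may have rank arrow `ω`, where the ranks of the wnodes must increase towards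
each infinite end. Such a walk is cut far out towards its infinite end, and the remaining part is
composed in a natural rank (`Flex`, `Stiff`). When neither is possible, a detour through a wnode of
rank `ω` is made (`exists_detour`); detours on both sides give the three pieces in `bridging_top`.

Finally, a walk of length less than `ω ^ (ρ + 1)` between wnodes of rank at most `ρ` is no shorter
than some `ρ`-walk (`exists_core_of_isWalkBetween`), so bridging in rank `ρ` applies to shortest
walks. -/

theorem natAdd_le_iff {a b c : Ordinal.{0}} :
    natAdd a b ≤ c ↔ (∀ a' < a, natAdd a' b < c) ∧ ∀ b' < b, natAdd a b' < c := by
  rw [natAdd, max_le_iff, Ordinal.iSup_le_iff, Ordinal.iSup_le_iff]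
  simp only [Order.succ_le_iff, Subtype.forall, Set.mem_Iio]

theorem natAdd_lt_natAdd_right {a a' : Ordinal.{0}} (h : a' < a) (b : Ordinal.{0}) :
    natAdd a' b < natAdd a b :=
  (natAdd_le_iff.1 le_rfl).1 _ h

theorem natAdd_lt_natAdd_left {b b' : Ordinal.{0}} (h : b' < b) (a : Ordinal.{0}) :
    natAdd a b' < natAdd a b :=
  (natAdd_le_iff.1 le_rfl).2 _ h

theorem natAdd_le_natAdd {a a' b b' : Ordinal.{0}} (ha : a ≤ a') (hb : b ≤ b') :
    natAdd a b ≤ natAdd a' b' := by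
  have h1 : natAdd a b ≤ natAdd a' b := by
    rcases ha.eq_or_lt with rfl | h
    · exact le_rfl
    · exact (natAdd_lt_natAdd_right h b).le
  refine h1.trans ?_
  rcases hb.eq_or_lt with rfl | h
  · exact le_rfl
  · exact (natAdd_lt_natAdd_left h a').le

theorem lt_natAdd_iff {a b c : Ordinal.{0}} :
    c < natAdd a b ↔ (∃ a' < a, c ≤ natAdd a' b) ∨ ∃ b' < b, c ≤ natAdd a b' := by
  rw [← not_le, natAdd_le_iff]
  push Not
  grind

theorem natAdd_comm (a b : Ordinal.{0}) : natAdd a b = natAdd b a := by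
  have key : ∀ a b : Ordinal.{0}, natAdd a b ≤ natAdd b a := by
    intro a
    induction a using WellFoundedLT.induction with
    | ind a iha =>
      intro b
      induction b using WellFoundedLT.induction with
      | ind b ihb =>
        rw [natAdd_le_iff]
        exact ⟨fun a' h => (iha a' h b).trans_lt (natAdd_lt_natAdd_left h b),
          fun b' h => (ihb b' h).trans_lt (natAdd_lt_natAdd_right h a)⟩
  exact le_antisymm (key a b) (key b a)

theorem natAdd_zero (a : Ordinal.{0}) : natAdd a 0 = a := by
  induction a using WellFoundedLT.induction with
  | ind a ih =>
    apply le_antisymm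
    · rw [natAdd_le_iff]
      exact ⟨fun a' h => by rwa [ih a' h], fun b' h => absurd h (not_lt.2 (zero_le))⟩
    · by_contra! h
      have := natAdd_lt_natAdd_right h 0
      rw [ih _ h] at this
      exact this.false

theorem zero_natAdd (a : Ordinal.{0}) : natAdd 0 a = a := by
  rw [natAdd_comm, natAdd_zero]

theorem le_natAdd_right (a b : Ordinal.{0}) : a ≤ natAdd a b := by
  conv_lhs => rw [← natAdd_zero a]
  exact natAdd_le_natAdd le_rfl (zero_le)

theorem le_natAdd_left (a b : Ordinal.{0}) : a ≤ natAdd b a := by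
  rw [natAdd_comm]
  exact le_natAdd_right a b

theorem natAdd_assoc (a b c : Ordinal.{0}) : natAdd (natAdd a b) c = natAdd a (natAdd b c) := by
  induction a using WellFoundedLT.induction generalizing b c with
  | ind a iha =>
    induction b using WellFoundedLT.induction generalizing c with
    | ind b ihb =>
      induction c using WellFoundedLT.induction with
      | ind c ihc =>
        apply le_antisymm
        · rw [natAdd_le_iff]
          constructor
          · intro d hd
            rcases lt_natAdd_iff.1 hd with ⟨a', h, h'⟩ | ⟨b', h, h'⟩
            · refine (natAdd_le_natAdd h' le_rfl).trans_lt ?_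
              rw [iha a' h]
              exact natAdd_lt_natAdd_right h _
            · refine (natAdd_le_natAdd h' le_rfl).trans_lt ?_
              rw [ihb b' h]
              exact natAdd_lt_natAdd_left (natAdd_lt_natAdd_right h _) _
          · intro c' h
            rw [ihc c' h]
            exact natAdd_lt_natAdd_left (natAdd_lt_natAdd_left h _) _
        · rw [natAdd_le_iff]
          constructor
          · intro a' h
            rw [← iha a' h]
            exact natAdd_lt_natAdd_right (natAdd_lt_natAdd_right h _) _
          · intro d hd
            rcases lt_natAdd_iff.1 hd with ⟨b', h, h'⟩ | ⟨c', h, h'⟩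
            · refine (natAdd_le_natAdd le_rfl h').trans_lt ?_
              rw [← ihb b' h]
              exact natAdd_lt_natAdd_right (natAdd_lt_natAdd_left h _) _
            · refine (natAdd_le_natAdd le_rfl h').trans_lt ?_
              rw [← ihc c' h]
              exact natAdd_lt_natAdd_left h _

instance natAdd_isAssociative : Std.Associative natAdd := ⟨natAdd_assoc⟩

instance natAdd_isCommutative : Std.Commutative natAdd := ⟨natAdd_comm⟩

theorem natAdd_le_natAdd_iff_left {a b c : Ordinal.{0}} : natAdd a b ≤ natAdd a c ↔ b ≤ c :=
  ⟨fun h => not_lt.1 fun h' => h.not_gt (natAdd_lt_natAdd_left h' a),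
    fun h => natAdd_le_natAdd le_rfl h⟩

/-- Ordinals below `t * i + a` have the form `t * i' + a'` with `(i', a')` lexicographically
smaller. A drop of `i` costs a full `t`, which exceeds any natural sum of two remainders. This feeds
the successor step of `natAdd_lt_omega0_opow`. -/
theorem natAdd_mul_add_le {t : Ordinal.{0}} (ht : ∀ a < t, ∀ b < t, natAdd a b < t)
    (i j : ℕ) {a b : Ordinal.{0}} (ha : a < t) (hb : b < t) :
    natAdd (t * i + a) (t * j + b) ≤ t * (i + j : ℕ) + natAdd a b := by
  have step : ∀ (i : ℕ) (a c : Ordinal.{0}), a < t → c < t * i + a →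
      ∃ i' : ℕ, ∃ a' < t, c = t * i' + a' ∧ (i' < i ∨ i' = i ∧ a' < a) := by
    intro i a c ha hc
    have ht0 : t ≠ 0 := (zero_le.trans_lt ha).ne'
    have hm : c % t < t := Ordinal.mod_lt c ht0
    have hdm := Ordinal.div_add_mod c t
    -- This makes the quotient of `c` by `t` finite, hence a natural number.
    have hlt : c / t < (i + 1 : ℕ) := by
      rw [← Ordinal.lt_mul_iff_div_lt ht0]
      refine hc.trans ?_
      push_cast
      rw [mul_add, mul_one]
      exact add_lt_add_right ha _
    obtain ⟨i', hi'⟩ := Ordinal.lt_omega0.1 (hlt.trans (Ordinal.natCast_lt_omega0 _))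
    rw [hi'] at hlt hdm
    refine ⟨i', c % t, hm, hdm.symm, ?_⟩
    have : i' < i + 1 := by exact_mod_cast hlt
    rcases Nat.lt_succ_iff_lt_or_eq.1 this with h | rfl
    · exact Or.inl h
    · refine Or.inr ⟨rfl, ?_⟩
      rw [← hdm] at hc
      exact lt_of_add_lt_add_left hc
  have bound : ∀ (p q : ℕ) (a d : Ordinal.{0}), p < q → a < t → t * p + a < t * q + d := by
    intro p q a d hpq ha
    calc t * p + a < t * p + t := add_lt_add_right ha _
      _ = t * ((p + 1 : ℕ) : Ordinal.{0}) := by push_cast; rw [mul_add, mul_one]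
      _ ≤ t * q := by
        have : ((p + 1 : ℕ) : Ordinal.{0}) ≤ q := by exact_mod_cast hpq
        gcongr
      _ ≤ t * q + d := le_self_add
  have main : ∀ x y : Ordinal.{0}, ∀ (i j : ℕ) (a b : Ordinal.{0}), a < t → b < t →
      x = t * i + a → y = t * j + b → natAdd x y ≤ t * (i + j : ℕ) + natAdd a b := by
    intro x
    induction x using WellFoundedLT.induction with
    | ind x ihx =>
      intro y
      induction y using WellFoundedLT.induction with
      | ind y ihy =>
        intro i j a b ha hb hx hy
        rw [natAdd_le_iff]
        constructor
        · intro x' hx'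
          obtain ⟨i', a', ha', he, h⟩ := step i a x' ha (hx ▸ hx')
          refine (ihx x' hx' y i' j a' b ha' hb he hy).trans_lt ?_
          rcases h with h | ⟨rfl, h⟩
          · exact bound _ _ _ _ (by omega) (ht _ ha' _ hb)
          · exact add_lt_add_right (natAdd_lt_natAdd_right h b) _
        · intro y' hy'
          obtain ⟨j', b', hb', he, h⟩ := step j b y' hb (hy ▸ hy')
          refine (ihy y' hy' i j' a b' ha hb' hx he).trans_lt ?_
          rcases h with h | ⟨rfl, h⟩
          · exact bound _ _ _ _ (by omega) (ht _ ha _ hb')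
          · exact add_lt_add_right (natAdd_lt_natAdd_left h a) _
  exact main _ _ i j a b ha hb rfl rfl

/-- At a successor, both ordinals are finite multiples of `ω ^ e` plus remainders, and
`natAdd_mul_add_le` adds the multiples. At a limit, both already lie below a common smaller power.
-/
theorem natAdd_lt_omega0_opow (e : Ordinal.{0}) :
    ∀ a < Ordinal.omega0 ^ e, ∀ b < Ordinal.omega0 ^ e, natAdd a b < Ordinal.omega0 ^ e := by
  induction e using Ordinal.limitRecOn with
  | zero =>
    intro a ha b hb
    rw [Ordinal.opow_zero, Order.lt_one_iff] at *
    rw [ha, hb, natAdd_zero]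
  | add_one e ih =>
    intro a ha b hb
    set t := Ordinal.omega0 ^ e with ht
    have ht0 : t ≠ 0 := (Ordinal.opow_pos e Ordinal.omega0_pos).ne'
    have rep : ∀ c < Ordinal.omega0 ^ (e + 1), ∃ i : ℕ, ∃ c' < t, c = t * i + c' := by
      intro c hc
      rw [← Order.succ_eq_add_one, Ordinal.opow_succ] at hc
      obtain ⟨i, hi⟩ := Ordinal.lt_omega0.1 ((Ordinal.lt_mul_iff_div_lt ht0).1 hc)
      refine ⟨i, c % t, Ordinal.mod_lt c ht0, ?_⟩
      rw [← hi, Ordinal.div_add_mod]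
    obtain ⟨i, a', ha', rfl⟩ := rep a ha
    obtain ⟨j, b', hb', rfl⟩ := rep b hb
    refine (natAdd_mul_add_le ih i j ha' hb').trans_lt ?_
    rw [← Order.succ_eq_add_one, Ordinal.lt_omega0_opow_succ]
    refine ⟨i + j + 1, ?_⟩
    calc t * ((i + j : ℕ) : Ordinal.{0}) + natAdd a' b'
        < t * ((i + j : ℕ) : Ordinal.{0}) + t := add_lt_add_right (ih _ ha' _ hb') _
      _ = t * ((i + j + 1 : ℕ) : Ordinal.{0}) := by push_cast; rw [mul_add _ _ 1, mul_one]
  | limit e he ih =>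
    intro a ha b hb
    obtain ⟨c, hc, hac⟩ := (Ordinal.lt_opow_of_isSuccLimit Ordinal.omega0_ne_zero he).1 ha
    obtain ⟨d, hd, hbd⟩ := (Ordinal.lt_opow_of_isSuccLimit Ordinal.omega0_ne_zero he).1 hb
    have hm : max c d < e := max_lt hc hd
    refine (ih _ hm a (hac.trans_le ?_) b (hbd.trans_le ?_)).trans_le ?_
    · exact Ordinal.opow_le_opow_right Ordinal.omega0_pos (le_max_left _ _)
    · exact Ordinal.opow_le_opow_right Ordinal.omega0_pos (le_max_right _ _)
    · exact Ordinal.opow_le_opow_right Ordinal.omega0_pos hm.le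

theorem natSum_congr {f g : ℤ → Ordinal.{0}} {a b : ℤ} {k : ℕ}
    (h : ∀ i : ℕ, i < k → f (a + i) = g (b + i)) : natSum f a k = natSum g b k := by
  induction k with
  | zero => rfl
  | succ k ih => rw [natSum, natSum, ih fun i hi => h i (by omega), h k (by omega)]

theorem natSum_le_natSum {f g : ℤ → Ordinal.{0}} {a b : ℤ} {k : ℕ}
    (h : ∀ i : ℕ, i < k → f (a + i) ≤ g (b + i)) : natSum f a k ≤ natSum g b k := by
  induction k with
  | zero => exact le_rfl
  | succ k ih => exact natAdd_le_natAdd (ih fun i hi => h i (by omega)) (h k (by omega))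

theorem natSum_lt_omega0_opow {f : ℤ → Ordinal.{0}} {a : ℤ} {k : ℕ} {e : Ordinal.{0}}
    (h : ∀ i : ℕ, i < k → f (a + i) < Ordinal.omega0 ^ e) : natSum f a k < Ordinal.omega0 ^ e := by
  induction k with
  | zero => exact Ordinal.opow_pos _ Ordinal.omega0_pos
  | succ k ih =>
    exact natAdd_lt_omega0_opow e _ (ih fun i hi => h i (by omega)) _ (h k (by omega))

theorem natSum_add (f : ℤ → Ordinal.{0}) (a : ℤ) (k l : ℕ) :
    natSum f a (k + l) = natAdd (natSum f a k) (natSum f (a + k) l) := by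
  induction l with
  | zero => simp [natSum, natAdd_zero]
  | succ l ih =>
    rw [← add_assoc, natSum, ih, natSum, natAdd_assoc]
    push_cast
    rw [add_assoc]

theorem natSum_one (f : ℤ → Ordinal.{0}) (a : ℤ) : natSum f a 1 = f a := by
  simp [natSum, zero_natAdd]

theorem natSum_reflect (f : ℤ → Ordinal.{0}) (a : ℤ) (k : ℕ) :
    natSum (fun m => f (a + k - 1 - m)) 0 k = natSum f a k := by
  induction k generalizing a with
  | zero => rfl
  | succ k ih =>
    rw [natSum, add_comm k 1, natSum_add, natSum_one, natAdd_comm]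
    congr 1
    · congr 1
      push_cast
      ring
    · rw [← ih (a + (1 : ℕ))]
      refine natSum_congr fun i _ => ?_
      congr 1
      push_cast
      ring

theorem le_natSum {f : ℤ → Ordinal.{0}} {a : ℤ} {k i : ℕ} (hi : i < k) :
    f (a + i) ≤ natSum f a k := by
  induction k with
  | zero => omega
  | succ k ih =>
    rcases Nat.lt_succ_iff_lt_or_eq.1 hi with h | rfl
    · exact (ih h).trans (le_natAdd_right _ _)
    · exact le_natAdd_left _ _

/-! ### Ranks -/

namespace WRank

/-- The natural number `n` as a rank. -/
def nat (n : ℕ) : WRank := ((n : ℕ∞) : WRank)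

theorem nat_lt_nat {m n : ℕ} : nat m < nat n ↔ m < n := by simp [nat]

theorem nat_le_nat {m n : ℕ} : nat m ≤ nat n ↔ m ≤ n := by simp [nat]

theorem nat_injective {m n : ℕ} (h : nat m = nat n) : m = n := by simpa [nat] using h

theorem nat_zero : nat 0 = 0 := rfl

theorem nat_ne_arrow (n : ℕ) : nat n ≠ arrow := by simp [nat, arrow]

theorem nat_lt_arrow (n : ℕ) : nat n < arrow := by
  simp only [nat, arrow, WithTop.coe_lt_coe]
  exact ENat.natCast_lt_top n

theorem nat_lt_top (n : ℕ) : nat n < ⊤ := WithTop.coe_lt_top _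

theorem arrow_lt_top : arrow < ⊤ := WithTop.coe_lt_top _

theorem cases (r : WRank) : (∃ n, r = nat n) ∨ r = arrow ∨ r = ⊤ := by
  induction r using WithTop.recTopCoe with
  | top => simp
  | coe r =>
    induction r using ENat.recTopCoe with
    | top => exact Or.inr (Or.inl rfl)
    | coe n => exact Or.inl ⟨n, rfl⟩

theorem exists_nat_of_lt_arrow {r : WRank} (h : r < arrow) : ∃ n, r = nat n := by
  rcases cases r with h' | rfl | rfl
  · exact h'
  · exact absurd h (lt_irrefl _)
  · exact absurd h (not_lt.2 le_top)

theorem le_arrow_of_lt_top {r : WRank} (h : r < ⊤) : r ≤ arrow := by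
  rcases cases r with ⟨n, rfl⟩ | rfl | rfl
  · exact (nat_lt_arrow n).le
  · exact le_rfl
  · exact absurd h (lt_irrefl _)

theorem eq_top_of_arrow_lt {r : WRank} (h : arrow < r) : r = ⊤ := by
  by_contra h'
  exact absurd (le_arrow_of_lt_top (lt_top_iff_ne_top.2 h')) (not_le.2 h)

theorem exists_nat_of_lt_nat {r : WRank} {n : ℕ} (h : r < nat n) : ∃ m, m < n ∧ r = nat m := by
  obtain ⟨m, rfl⟩ := exists_nat_of_lt_arrow (h.trans (nat_lt_arrow n))
  exact ⟨m, nat_lt_nat.1 h, rfl⟩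

theorem next_nat (n : ℕ) : next (nat n) = nat (n + 1) := by
  rw [next, if_neg (nat_ne_arrow n)]
  simp [nat]

theorem next_arrow : next arrow = ⊤ := by rw [next, if_pos rfl]

theorem next_le_of_lt {r s : WRank} (h : r < s) (hs : s ≠ arrow) : next r ≤ s := by
  rcases cases r with ⟨n, rfl⟩ | rfl | rfl
  · rw [next_nat]
    rcases cases s with ⟨m, rfl⟩ | rfl | rfl
    · exact nat_le_nat.2 (nat_lt_nat.1 h)
    · exact absurd rfl hs
    · exact le_top
  · rw [eq_top_of_arrow_lt h]; exact le_top
  · exact absurd h (not_lt.2 le_top)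

theorem tipExponent_nat (n : ℕ) : (nat n).tipExponent = n + 1 := rfl

theorem exponent_nat (n : ℕ) : (nat n).exponent = n := rfl

theorem tipExponent_strictMono {r s : WRank} (h : r < s) : r.tipExponent < s.tipExponent := by
  rcases cases r with ⟨n, rfl⟩ | rfl | rfl
  · have hn : (nat n).tipExponent < Ordinal.omega0 := by
      rw [tipExponent_nat]
      exact_mod_cast Ordinal.natCast_lt_omega0 (n + 1)
    rcases cases s with ⟨m, rfl⟩ | rfl | rfl
    · have := nat_lt_nat.1 h
      rw [tipExponent_nat, tipExponent_nat]
      exact_mod_cast Nat.succ_lt_succ this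
    · exact hn
    · exact hn.trans (Order.lt_add_one_iff.2 le_rfl)
  · rw [eq_top_of_arrow_lt h]
    exact Order.lt_add_one_iff.2 le_rfl
  · exact absurd h (not_lt.2 le_top)

theorem tipExponent_le_exponent {r s : WRank} (h : r < s) (hs : s ≠ arrow) :
    r.tipExponent ≤ s.exponent := by
  rcases cases s with ⟨n, rfl⟩ | rfl | rfl
  · obtain ⟨m, hm, rfl⟩ := exists_nat_of_lt_nat h
    rw [tipExponent_nat, exponent_nat]
    exact_mod_cast hm
  · exact absurd rfl hs
  · rcases (le_arrow_of_lt_top h).eq_or_lt with rfl | h'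
    · exact le_rfl
    · exact (tipExponent_strictMono h').le

theorem exponent_lt_tipExponent {r s : WRank} (h : s ≤ r) (hs : s ≠ arrow) :
    s.exponent < r.tipExponent := by
  have : s.exponent < s.tipExponent := by
    rcases cases s with ⟨n, rfl⟩ | rfl | rfl
    · rw [tipExponent_nat, exponent_nat]
      exact Order.lt_add_one_iff.2 le_rfl
    · exact absurd rfl hs
    · exact Order.lt_add_one_iff.2 le_rfl
  rcases h.eq_or_lt with rfl | h
  · exact this
  · exact this.trans (tipExponent_strictMono h)

end WRank

/-! ### Reversal -/

namespace WSeq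

variable {X : Type u}

theorem reverse_reverse (W : WSeq X) : W.reverse.reverse = W := by
  induction W with
  | branch b => rfl
  | seq r lo hi x P ih =>
    simp only [reverse, Option.map_map]
    congr 1
    · cases lo <;> simp
    · cases hi <;> simp
    · funext m; simp
    · funext m
      have : (-1 - (-1 - m) : ℤ) = m := by ring
      rw [this, ih]

theorem rank_reverse (W : WSeq X) : W.reverse.rank = W.rank := by cases W <;> rfl

theorem Same.refl (W : WSeq X) : Same W W := by
  induction W with
  | branch b => exact Same.branch b
  | seq r lo hi x P ih =>
    refine Same.seq 0 ?_ ?_ (fun m _ => by rw [add_zero]) fun m _ => by rw [add_zero]; exact ih m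
    · cases lo <;> simp
    · cases hi <;> simp

/-- The walk extends infinitely to the right. -/
def RInf : WSeq X → Prop
  | seq _ _ none _ _ => True
  | _ => False

/-- The walk extends infinitely to the left. -/
def LInf (W : WSeq X) : Prop := W.reverse.RInf

end WSeq

theorem nodeIdx_neg {lo hi : Option ℤ} {m : ℤ} :
    NodeIdx (hi.map Neg.neg) (lo.map Neg.neg) m ↔ NodeIdx lo hi (-m) := by
  unfold NodeIdx
  cases lo <;> cases hi <;> simp <;> omega

theorem pieceIdx_neg {lo hi : Option ℤ} {m : ℤ} :
    PieceIdx (hi.map Neg.neg) (lo.map Neg.neg) m ↔ PieceIdx lo hi (-1 - m) := by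
  unfold PieceIdx
  cases lo <;> cases hi <;> simp <;> omega

theorem innerIdx_neg {lo hi : Option ℤ} {m : ℤ} :
    InnerIdx (hi.map Neg.neg) (lo.map Neg.neg) m ↔ InnerIdx lo hi (-m) := by
  unfold InnerIdx
  cases lo <;> cases hi <;> simp <;> omega

theorem WSeq.nontrivial_reverse {X : Type u} {W : WSeq X} :
    W.reverse.Nontrivial ↔ W.Nontrivial := by
  cases W with
  | branch b => rfl
  | seq r lo hi x P =>
    simp only [WSeq.reverse, WSeq.Nontrivial, pieceIdx_neg]
    constructor
    · rintro ⟨m, h⟩; exact ⟨_, h⟩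
    · rintro ⟨m, h⟩
      refine ⟨-1 - m, ?_⟩
      have : (-1 - (-1 - m) : ℤ) = m := by ring
      rwa [this]

theorem WSeq.length_reverse {X : Type u} (W : WSeq X) : W.reverse.length = W.length := by
  induction W with
  | branch b => rfl
  | seq r lo hi x P ih =>
    cases lo with
    | none => cases hi <;> simp [WSeq.reverse, WSeq.length]
    | some a =>
      cases hi with
      | none => simp [WSeq.reverse, WSeq.length]
      | some b =>
        simp only [WSeq.reverse, WSeq.length, Option.map_some, ih]
        have hab : (-a - -b).toNat = (b - a).toNat := by congr 1; ring
        rw [hab]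
        generalize hk : (b - a).toNat = k
        rw [← natSum_reflect]
        -- For `b < a` the truncated difference is `0` and `b - a = k` fails, so this case is set
        -- apart.
        rcases Nat.eq_zero_or_pos k with rfl | hpos
        · rfl
        refine natSum_congr fun i _ => ?_
        congr 2
        have : b - a = k := by omega
        omega

/-! ### Local form of the walk conditions -/

namespace PreWGraph

variable {X : Type u} (G : PreWGraph X)

/-- The conditions on the piece `p` of an `r`-walk between the wnodes `a` and `b`. -/
def PieceOK (r : WRank) (a : X) (p : WSeq X) (b : X) : Prop :=
  if r = 0 then p = .branch s(a, b) ∧ s(a, b) ∈ G.branches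
  else G.IsWalk p ∧ p.Nontrivial ∧ p.rank < r ∧ G.LeftReach a p ∧ G.RightReach b p

/-- The conditions on a nonterminal wnode `a` of an `r`-walk between the pieces `p` and `q`, apart
from those on the shape of walks of rank arrow `ω`. -/
def NodeOK (r : WRank) (p : WSeq X) (a : X) (q : WSeq X) : Prop :=
  r ≠ 0 → (G.RightTip a p ∨ G.LeftTip a q) ∧ (r ≠ WRank.arrow → G.rank a = r)

/-- The conditions on an `r`-walk, apart from those on the shape of walks of rank arrow `ω`. -/
structure Core (r : WRank) (lo hi : Option ℤ) (x : ℤ → X) (P : ℤ → WSeq X) : Prop where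
  le : ∀ a ∈ lo, ∀ b ∈ hi, a ≤ b
  rank_le : ∀ m, NodeIdx lo hi m → G.rank (x m) ≤ r
  piece : ∀ m, PieceIdx lo hi m → G.PieceOK r (x m) (P m) (x (m + 1))
  node : ∀ m, InnerIdx lo hi m → G.NodeOK r (P (m - 1)) (x m) (P m)

variable {G} {r : WRank} {lo hi : Option ℤ} {x : ℤ → X} {P : ℤ → WSeq X}

/-- `Core` gathers the local conditions. They survive restriction, shifting, reversal and gluing, so
that only the global shape of walks of rank arrow `ω` needs separate care. -/
theorem isWalk_iff : G.IsWalk (.seq r lo hi x P) ↔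
    G.Core r lo hi x P ∧ (r = WRank.arrow → G.ArrowShape lo hi x P) := by
  rw [IsWalk]
  by_cases h0 : r = 0
  · have hna : r ≠ WRank.arrow := by rw [h0]; exact WRank.nat_ne_arrow 0
    simp only [h0, if_true]
    constructor
    · rintro ⟨h1, h2, h3⟩
      refine ⟨⟨h1, h2, fun m hm => ?_, fun m _ h => absurd rfl h⟩, fun h => absurd (h0.trans h) hna⟩
      rw [PieceOK, if_pos rfl]
      exact h3 m hm
    · rintro ⟨⟨h1, h2, h3, -⟩, -⟩
      refine ⟨h1, h2, fun m hm => ?_⟩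
      have := h3 m hm
      rwa [PieceOK, if_pos rfl] at this
  · simp only [h0, if_false]
    constructor
    · rintro ⟨h1, h2, h3, h4, h5⟩
      refine ⟨⟨h1, h2, fun m hm => ?_, fun m hm _ => ⟨h4 m hm, fun hna => ?_⟩⟩, fun ha => ?_⟩
      · rw [PieceOK, if_neg h0]; exact h3 m hm
      · rw [if_neg hna] at h5; exact h5 m hm
      · rwa [if_pos ha] at h5
    · rintro ⟨⟨h1, h2, h3, h4⟩, h5⟩
      refine ⟨h1, h2, fun m hm => ?_, fun m hm => (h4 m hm h0).1, ?_⟩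
      · have := h3 m hm
        rwa [PieceOK, if_neg h0] at this
      · split_ifs with ha
        · exact h5 ha
        · exact fun m hm => (h4 m hm h0).2 ha

theorem IsWalk.core (h : G.IsWalk (.seq r lo hi x P)) : G.Core r lo hi x P := (isWalk_iff.1 h).1

theorem Core.isWalk (h : G.Core r lo hi x P) (hr : r ≠ WRank.arrow) :
    G.IsWalk (.seq r lo hi x P) := isWalk_iff.2 ⟨h, fun h => absurd h hr⟩

theorem leftTip_reverse {y : X} {W : WSeq X} : G.LeftTip y W.reverse ↔ G.RightTip y W := by
  rw [LeftTip, WSeq.reverse_reverse]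

theorem leftReach_reverse {y : X} {W : WSeq X} : G.LeftReach y W.reverse ↔ G.RightReach y W := by
  rw [LeftReach, WSeq.reverse_reverse]

theorem NodeOK.reverse {p q : WSeq X} {a : X} (h : G.NodeOK r p a q) :
    G.NodeOK r q.reverse a p.reverse := by
  intro h0
  obtain ⟨h1, h2⟩ := h h0
  exact ⟨h1.symm.imp id leftTip_reverse.2, h2⟩

theorem Core.reverse_of (h : G.Core r lo hi x P)
    (ih : ∀ m, PieceIdx lo hi m → G.IsWalk (P m) → G.IsWalk (P m).reverse) :
    G.Core r (hi.map Neg.neg) (lo.map Neg.neg) (fun m => x (-m)) fun m => (P (-1 - m)).reverse where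
  le := by
    have := h.le
    cases lo <;> cases hi <;> simp at this ⊢
    exact this
  rank_le m hm := h.rank_le _ (nodeIdx_neg.1 hm)
  piece m hm := by
    rw [pieceIdx_neg] at hm
    have := h.piece _ hm
    have e1 : (-1 - m + 1 : ℤ) = -m := by ring
    have e2 : (-(m + 1) : ℤ) = -1 - m := by ring
    rw [e1] at this
    rw [e2]
    unfold PieceOK at *
    split_ifs at this ⊢ with h0
    · obtain ⟨h1, h2⟩ := this
      rw [h1, Sym2.eq_swap]
      exact ⟨rfl, Sym2.eq_swap ▸ h2⟩
    · obtain ⟨h1, h2, h3, h4, h5⟩ := this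
      exact ⟨ih _ hm h1, WSeq.nontrivial_reverse.2 h2, by rwa [WSeq.rank_reverse],
        leftReach_reverse.2 h5, h4⟩
  node m hm := by
    have := (h.node _ (innerIdx_neg.1 hm)).reverse
    have e1 : (-1 - (m - 1) : ℤ) = -m := by ring
    have e2 : (-1 - m : ℤ) = -m - 1 := by ring
    rwa [e1, e2]

theorem ArrowShape.reverse (h : G.ArrowShape lo hi x P) :
    G.ArrowShape (hi.map Neg.neg) (lo.map Neg.neg) (fun m => x (-m))
      fun m => (P (-1 - m)).reverse := by
  obtain ⟨h1, p, h2, h3, h4⟩ := h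
  refine ⟨by simpa using h1.symm, -1 - p, ?_, ?_, fun m hm => ?_⟩
  · cases hi with
    | none => simp
    | some b =>
      have := h3 b rfl
      simp
      omega
  · cases lo with
    | none => simp
    | some a =>
      have := h2 a rfl
      simp
      omega
  · obtain ⟨h5, h6⟩ := h4 _ (pieceIdx_neg.1 hm)
    have e1 : (-1 - m + 1 : ℤ) = -m := by ring
    have e2 : (-(m + 1) : ℤ) = -1 - m := by ring
    rw [e1] at h5 h6
    simp only [WSeq.rank_reverse, e2]
    exact ⟨fun h => h6 (by omega), fun h => h5 (by omega)⟩

theorem IsWalk.reverse {W : WSeq X} (h : G.IsWalk W) : G.IsWalk W.reverse := by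
  induction W with
  | branch b => simp [IsWalk] at h
  | seq r lo hi x P ih =>
    rw [isWalk_iff] at h
    exact isWalk_iff.2 ⟨h.1.reverse_of fun m _ => ih m, fun ha => (h.2 ha).reverse⟩

theorem Core.reverse (h : G.Core r lo hi x P) :
    G.Core r (hi.map Neg.neg) (lo.map Neg.neg) (fun m => x (-m)) fun m => (P (-1 - m)).reverse :=
  h.reverse_of fun _ _ => IsWalk.reverse

end PreWGraph

/-! ### Embracing wnodes -/

namespace PreWGraph

variable {X : Type u} {G : PreWGraph X}

theorem Embraces.refl (x : X) : G.Embraces x x := Relation.ReflTransGen.refl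

theorem Embraces.trans {x y z : X} (h1 : G.Embraces x y) (h2 : G.Embraces y z) : G.Embraces x z :=
  Relation.ReflTransGen.trans h2 h1

theorem Linked.refl (x : X) : G.Linked x x := Or.inl (Embraces.refl x)

theorem Linked.symm {x y : X} (h : G.Linked x y) : G.Linked y x := Or.symm h

end PreWGraph

namespace WGraph

variable {X : Type u} {ν : WRank} (G : WGraph X ν)

theorem Embraces.rank_lt {x y : X} (h : G.Embraces x y) (hne : x ≠ y) : G.rank y < G.rank x := by
  have : G.rank y < G.rank x ∨ x = y := by
    induction h with
    | refl => exact Or.inr rfl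
    | @tail b c _ h ih =>
      refine Or.inl ?_
      rcases eq_or_ne y b with rfl | hne'
      · exact G.elem_rank _ _ h
      · rcases ih hne'.symm with ih | ih
        · exact ih.trans (G.elem_rank _ _ h)
        · exact absurd ih.symm hne'
  exact this.resolve_right hne

theorem eq_of_linked {x y : X} (h : G.Linked x y) (hr : G.rank x = G.rank y) : x = y := by
  by_contra hne
  rcases h with h | h
  · exact (Embraces.rank_lt G h hne).ne hr.symm
  · exact (Embraces.rank_lt G h (Ne.symm hne)).ne hr

theorem nest_rank_ne_arrow {s : ℕ → X} (hs : G.IsNest s) (k : ℕ) :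
    G.rank (s k) ≠ WRank.arrow := by
  intro h
  have h1 := G.elem_rank _ _ (hs.1 k)
  rw [h] at h1
  have h2 := G.elem_rank _ _ (hs.1 (k + 1))
  rw [WRank.eq_top_of_arrow_lt h1] at h2
  exact absurd h2 (not_lt.2 le_top)

theorem embraces_nest {s : ℕ → X} (hs : G.IsNest s) {i j : ℕ} (h : i ≤ j) :
    G.Embraces (s j) (s i) := by
  induction h with
  | refl => exact PreWGraph.Embraces.refl _
  | step _ ih => exact Relation.ReflTransGen.tail ih (hs.1 _)

/-- What a wnode embraces is a chain: a wnode of rank other than arrow `ω` has at most one element,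
and the elements of a wnode of rank arrow `ω` are nested, so the later of two of them embraces the
other. -/
theorem linked_of_embraces_down {y x z : X} (hx : G.Embraces y x) (hz : G.Embraces y z) :
    G.Linked x z := by
  induction hr : G.rank y using WellFoundedLT.induction generalizing y with
  | ind r ih =>
    subst hr
    rcases Relation.ReflTransGen.cases_tail hx with rfl | ⟨x1, hx1, hx1y⟩
    · exact Or.inl hz
    rcases Relation.ReflTransGen.cases_tail hz with rfl | ⟨z1, hz1, hz1y⟩
    · exact Or.inr hx
    by_cases ha : G.rank y = WRank.arrow
    · obtain ⟨s, hs, hsy⟩ := G.arrow_spec y ha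
      obtain ⟨i, rfl⟩ := (hsy _).1 hx1y
      obtain ⟨j, rfl⟩ := (hsy _).1 hz1y
      exact ih _ (G.elem_rank _ _ ((hsy _).2 ⟨max i j, rfl⟩))
        ((embraces_nest G hs (le_max_left i j)).trans hx1)
        ((embraces_nest G hs (le_max_right i j)).trans hz1) rfl
    · obtain rfl := G.elem_unique _ _ _ ha hx1y hz1y
      exact ih _ (G.elem_rank _ _ hx1y) hx1 hz1 rfl

/-- One common term forces all terms of `s` to occur in `s'`: upwards because a wnode is an element
of only one wnode of rank other than arrow `ω`, downwards because a term has only one element. Then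
`arrow_complete` identifies the two wnodes. -/
theorem nest_eq_of_arrow {z z' : X} {s s' : ℕ → X} (hz : G.rank z = WRank.arrow)
    (hz' : G.rank z' = WRank.arrow) (hs : G.IsNest s) (hs' : G.IsNest s')
    (hsz : ∀ k, G.elem (s k) z) (hsz' : ∀ y, G.elem y z' ↔ ∃ k, y = s' k)
    {k k' : ℕ} (h : s k = s' k') : z = z' := by
  have up : ∀ i, ∃ j, s (k + i) = s' j := by
    intro i
    induction i with
    | zero => exact ⟨k', h⟩
    | succ i ih =>
      obtain ⟨j, hj⟩ := ih
      refine ⟨j + 1, ?_⟩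
      have h1 := hs.1 (k + i)
      have h2 := hs'.1 j
      rw [← hj] at h2
      exact G.elem_disjoint _ _ _ (nest_rank_ne_arrow G hs _) (nest_rank_ne_arrow G hs' _) h1 h2
  have down : ∀ i j, s i = s' j → ∀ l ≤ i, ∃ j, s l = s' j := by
    intro i
    induction i with
    | zero =>
      intro j hj l hl
      obtain rfl : l = 0 := by omega
      exact ⟨j, hj⟩
    | succ i ih =>
      intro j hj l hl
      rcases hl.eq_or_lt with rfl | hl
      · exact ⟨j, hj⟩
      have h1 := hs.1 i
      cases j with
      | zero => rw [hj] at h1; exact absurd h1 (hs'.2 _)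
      | succ j =>
        have h2 := hs'.1 j
        rw [← hj] at h2
        exact ih j (G.elem_unique _ _ _ (nest_rank_ne_arrow G hs _) h1 h2) l (by omega)
  have all : ∀ i, G.elem (s i) z' := by
    intro i
    rw [hsz']
    obtain ⟨j, hj⟩ := up i
    exact down _ _ hj i (by omega)
  obtain ⟨w, -, hw⟩ := G.arrow_complete s hs
  rw [hw z ⟨hz, hsz⟩, hw z' ⟨hz', all⟩]

/-- From a term of the nest, one membership step upwards leads only to the next term or to `z`
itself. -/
theorem embraces_nest_or {z : X} {s : ℕ → X} (hz : G.rank z = WRank.arrow) (hs : G.IsNest s)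
    (hsz : ∀ y, G.elem y z ↔ ∃ k, y = s k) {k : ℕ} {w : X} (hw : G.Embraces w (s k)) :
    G.elem w z ∨ G.Embraces w z := by
  induction hw with
  | refl => exact Or.inl ((hsz _).2 ⟨k, rfl⟩)
  | @tail b c _ hbc ih =>
    rcases ih with ih | ih
    · obtain ⟨i, rfl⟩ := (hsz _).1 ih
      by_cases hc : G.rank c = WRank.arrow
      · right
        obtain ⟨s', hs', hsc⟩ := G.arrow_spec c hc
        obtain ⟨j, hj⟩ := (hsc _).1 hbc
        rw [nest_eq_of_arrow G hz hc hs hs' (fun k => (hsz _).2 ⟨k, rfl⟩) hsc hj]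
        exact PreWGraph.Embraces.refl _
      · left
        rw [G.elem_disjoint _ _ _ hc (nest_rank_ne_arrow G hs (i + 1)) hbc (hs.1 i), hsz]
        exact ⟨_, rfl⟩
    · exact Or.inr (Relation.ReflTransGen.tail ih hbc)

theorem linked_of_embraces_up {y x z : X} (hx : G.Embraces x y) (hz : G.Embraces z y) :
    G.Linked x z := by
  unfold PreWGraph.Embraces at hx
  induction hx using Relation.ReflTransGen.head_induction_on with
  | refl => exact Or.inr hz
  | @head y x1 hyx1 hx1 ih =>
    rcases Relation.ReflTransGen.cases_head hz with rfl | ⟨z1, hyz1, hz1⟩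
    · exact Or.inl (Relation.ReflTransGen.head hyx1 hx1)
    by_cases hxa : G.rank x1 = WRank.arrow
    · obtain ⟨s, hs, hsx⟩ := G.arrow_spec x1 hxa
      obtain ⟨k, rfl⟩ := (hsx _).1 hyx1
      rcases embraces_nest_or G hxa hs hsx hz with h | h
      · exact Or.inl (Relation.ReflTransGen.head h hx1)
      · exact ih h
    · by_cases hza : G.rank z1 = WRank.arrow
      · obtain ⟨s, hs, hsz⟩ := G.arrow_spec z1 hza
        obtain ⟨k, rfl⟩ := (hsz _).1 hyz1
        have : G.Embraces x1 (s k) := Relation.ReflTransGen.single hyx1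
        rcases embraces_nest_or G hza hs hsz this with h | h
        · exact ih (Relation.ReflTransGen.head h hz1)
        · by_cases he : x1 = z1
          · subst he; exact ih hz1
          · exfalso
            have h1 := Embraces.rank_lt G h he
            have h2 : G.Embraces x1 (s (k + 1)) := by
              rw [G.elem_disjoint _ _ _ hxa (nest_rank_ne_arrow G hs (k + 1)) hyx1 (hs.1 k)]
              exact PreWGraph.Embraces.refl _
            rw [G.elem_disjoint _ _ _ hxa (nest_rank_ne_arrow G hs (k + 1)) hyx1 (hs.1 k)] at h1
            exact absurd (G.elem_rank _ _ ((hsz _).2 ⟨k + 1, rfl⟩)) (not_lt.2 h1.le)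
      · obtain rfl := G.elem_disjoint _ _ _ hxa hza hyx1 hyz1
        exact ih hz1

variable {G}

/-- Linkedness is thus an equivalence relation, and reaching a wnode depends only on its class. -/
theorem Linked.trans {x y z : X} (h1 : G.Linked x y) (h2 : G.Linked y z) : G.Linked x z := by
  rcases h1 with h1 | h1 <;> rcases h2 with h2 | h2
  · exact Or.inl (h1.trans h2)
  · exact linked_of_embraces_up G h1 h2
  · exact linked_of_embraces_down G h1 h2
  · exact Or.inr (PreWGraph.Embraces.trans h2 h1)

theorem RightReach.linked {W : WSeq X} {y z : X} (h : G.RightReach y W) (hyz : G.Linked y z) :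
    G.RightReach z W := by
  rcases W with b | ⟨r, lo, hi, x, P⟩
  · exact h.elim
  · cases hi with
    | some b => exact Linked.trans (G := G) h hyz
    | none =>
      obtain ⟨w, h1, h2⟩ := h
      exact ⟨w, Linked.trans h1 hyz, h2⟩

theorem LeftReach.linked {W : WSeq X} {y z : X} (h : G.LeftReach y W) (hyz : G.Linked y z) :
    G.LeftReach z W :=
  RightReach.linked h hyz

/-! ### Wtips -/

theorem rightReach_of_rightTip {W : WSeq X} {y : X} (h : G.RightTip y W) : G.RightReach y W := by
  rcases W with b | ⟨r, lo, hi, x, P⟩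
  · exact h.elim
  · cases hi with
    | some b => exact h.elim
    | none => exact ⟨y, PreWGraph.Linked.refl _, h⟩

theorem leftReach_of_leftTip {W : WSeq X} {y : X} (h : G.LeftTip y W) : G.LeftReach y W :=
  rightReach_of_rightTip h

theorem rInf_of_rightTip {W : WSeq X} {y : X} (h : G.RightTip y W) : W.RInf := by
  rcases W with b | ⟨r, lo, hi, x, P⟩
  · exact h.elim
  · cases hi with
    | some b => exact h.elim
    | none => trivial

theorem exists_rightTip_of_rightReach {W : WSeq X} {y : X} (h : G.RightReach y W) (hW : W.RInf) :
    ∃ z, G.Linked z y ∧ G.RightTip z W := by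
  rcases W with b | ⟨r, lo, hi, x, P⟩
  · exact h.elim
  · cases hi with
    | some b => exact hW.elim
    | none => exact h

theorem rank_of_rightTip {W : WSeq X} {y : X} (h : G.RightTip y W) : G.rank y = W.rank.next := by
  rcases W with b | ⟨r, lo, hi, x, P⟩
  · exact h.elim
  · cases hi with
    | some b => exact h.elim
    | none =>
      obtain ⟨k, -, hk⟩ := h
      exact (G.tip_spec _ _ hk).2.2

theorem rank_of_leftTip {W : WSeq X} {y : X} (h : G.LeftTip y W) : G.rank y = W.rank.next := by
  rw [← WSeq.rank_reverse]
  exact rank_of_rightTip h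

theorem _root_.PreWGraph.Core.restrict {G : PreWGraph X} {r : WRank} {lo hi lo' hi' : Option ℤ}
    {x : ℤ → X} {P : ℤ → WSeq X} (h : G.Core r lo hi x P)
    (hle : ∀ a ∈ lo', ∀ b ∈ hi', a ≤ b)
    (hlo : ∀ a ∈ lo, ∃ a' ∈ lo', a ≤ a') (hhi : ∀ b ∈ hi, ∃ b' ∈ hi', b' ≤ b) :
    G.Core r lo' hi' x P := by
  have h1 : ∀ m, (∀ a' ∈ lo', a' ≤ m) → ∀ a ∈ lo, a ≤ m := fun m hm a ha => by
    obtain ⟨a', ha', h⟩ := hlo a ha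
    exact h.trans (hm _ ha')
  have h2 : ∀ m, (∀ b' ∈ hi', m ≤ b') → ∀ b ∈ hi, m ≤ b := fun m hm b hb => by
    obtain ⟨b', hb', h⟩ := hhi b hb
    exact (hm _ hb').trans h
  have h3 : ∀ m, (∀ a' ∈ lo', a' < m) → ∀ a ∈ lo, a < m := fun m hm a ha => by
    obtain ⟨a', ha', h⟩ := hlo a ha
    exact h.trans_lt (hm _ ha')
  have h4 : ∀ m, (∀ b' ∈ hi', m < b') → ∀ b ∈ hi, m < b := fun m hm b hb => by
    obtain ⟨b', hb', h⟩ := hhi b hb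
    exact (hm _ hb').trans_le h
  exact ⟨hle, fun m hm => h.rank_le m ⟨h1 m hm.1, h2 m hm.2⟩,
    fun m hm => h.piece m ⟨h1 m hm.1, h4 m hm.2⟩, fun m hm => h.node m ⟨h3 m hm.1, h4 m hm.2⟩⟩

/-- Wtips are given by one-ended representatives, so tails must again be walks. In rank arrow `ω`
the tail has to start at or beyond the exceptional piece `p`, which gives the threshold `K`. -/
theorem exists_tail_isWalk {r : WRank} {lo : Option ℤ} {x : ℤ → X} {P : ℤ → WSeq X}
    (h : G.IsWalk (.seq r lo none x P)) :
    ∃ K, ∀ k ≥ K, NodeIdx lo none k ∧ G.IsWalk (.seq r (some k) none x P) := by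
  rw [PreWGraph.isWalk_iff] at h
  obtain ⟨K1, hK1⟩ : ∃ K1 : ℤ, ∀ a ∈ lo, a ≤ K1 := by
    cases lo with
    | none => exact ⟨0, by simp⟩
    | some a => exact ⟨a, by simp⟩
  obtain ⟨K2, hK2⟩ : ∃ K2 : ℤ, ∀ k ≥ K2, r = WRank.arrow → G.ArrowShape (some k) none x P := by
    by_cases hr : r = WRank.arrow
    · obtain ⟨-, p, h2, h3, h4⟩ := h.2 hr
      refine ⟨max p K1, fun k hk _ => ⟨Or.inr rfl, p, ?_, by simp, fun m hm => h4 m ?_⟩⟩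
      · simp
        omega
      · refine ⟨fun a ha => ?_, by simp⟩
        have := hK1 a ha
        have := hm.1 k rfl
        omega
    · exact ⟨0, fun k _ h => absurd h hr⟩
  refine ⟨max K1 K2, fun k hk => ⟨⟨fun a ha => (hK1 a ha).trans (by omega), by simp⟩, ?_⟩⟩
  rw [PreWGraph.isWalk_iff]
  refine ⟨h.1.restrict (by simp) (fun a ha => ⟨k, rfl, (hK1 a ha).trans (by omega)⟩) (by simp),
    hK2 k (by omega)⟩

/-- A wtip sees only the far end of a walk, so surgery elsewhere preserves it. This is how all the
constructions below keep their outer ends. -/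
theorem rightTip_of_agree {r : WRank} {lo lo' : Option ℤ} {x x' : ℤ → X} {P P' : ℤ → WSeq X}
    {u : X} (hu : G.RightTip u (.seq r lo none x P)) (hw : G.IsWalk (.seq r lo' none x' P'))
    (N s : ℤ) (hx : ∀ m > N, x m = x' (m + s)) (hP : ∀ m > N, P m = P' (m + s)) :
    G.RightTip u (.seq r lo' none x' P') := by
  obtain ⟨k, -, hk⟩ := hu
  obtain ⟨K, hK⟩ := exists_tail_isWalk hw
  obtain ⟨h1, h2⟩ := hK K le_rfl
  refine ⟨K, h1, G.tip_congr u (.seq r (some k) none x P) _ h2 trivial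
    ⟨rfl, N + 1, s, fun m hm => ?_⟩ hk⟩
  rw [hx m (by omega), hP m (by omega)]
  exact ⟨rfl, WSeq.Same.refl _⟩

theorem rightReach_of_agree {r : WRank} {lo lo' hi : Option ℤ} {x x' : ℤ → X} {P P' : ℤ → WSeq X}
    {u : X} (s : ℤ) (hu : G.RightReach u (.seq r lo hi x P))
    (hw : G.IsWalk (.seq r lo' (hi.map (· + s)) x' P'))
    (N : ℤ) (hx : ∀ m > N, x m = x' (m + s)) (hP : ∀ m > N, P m = P' (m + s))
    (hb : ∀ b ∈ hi, x b = x' (b + s)) :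
    G.RightReach u (.seq r lo' (hi.map (· + s)) x' P') := by
  cases hi with
  | some b =>
    have h := hb b rfl
    simp only [Option.map_some, PreWGraph.RightReach] at hu ⊢
    rwa [← h]
  | none =>
    obtain ⟨y, h1, h2⟩ := hu
    exact ⟨y, h1, rightTip_of_agree h2 hw N s hx hP⟩

theorem rightTip_unique {W : WSeq X} {y z : X} (hr : W.rank < ν) (hW : G.IsWalk W)
    (hy : G.RightTip y W) (hz : G.RightTip z W) : y = z := by
  rcases W with b | ⟨r, lo, hi, x, P⟩
  · exact hy.elim
  cases hi with
  | some b => exact hy.elim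
  | none =>
    obtain ⟨K, hK⟩ := exists_tail_isWalk hW
    obtain ⟨-, h2⟩ := hK K le_rfl
    have key : ∀ w, G.RightTip w (.seq r lo none x P) → G.tip w (.seq r (some K) none x P) := by
      rintro w ⟨k, -, hk⟩
      exact G.tip_congr w (.seq r (some k) none x P) _ h2 trivial
        ⟨rfl, 0, 0, fun m _ => by rw [add_zero]; exact ⟨rfl, WSeq.Same.refl _⟩⟩ hk
    exact (G.tip_partition _ h2 trivial hr).unique (key y hy) (key z hz)

theorem rightReach_unique {W : WSeq X} {y z : X} (hr : W.rank < ν) (hW : G.IsWalk W)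
    (hy : G.RightReach y W) (hz : G.RightReach z W) : G.Linked y z := by
  rcases W with b | ⟨r, lo, hi, x, P⟩
  · exact hy.elim
  cases hi with
  | some b => exact Linked.trans (PreWGraph.Linked.symm (G := G.toPreWGraph) hy) hz
  | none =>
    obtain ⟨y', hy1, hy2⟩ := hy
    obtain ⟨z', hz1, hz2⟩ := hz
    obtain rfl := rightTip_unique hr hW hy2 hz2
    exact Linked.trans hy1.symm hz1

theorem leftReach_unique {W : WSeq X} {y z : X} (hr : W.rank < ν) (hW : G.IsWalk W)
    (hy : G.LeftReach y W) (hz : G.LeftReach z W) : G.Linked y z :=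
  rightReach_unique (by rwa [WSeq.rank_reverse]) hW.reverse hy hz

theorem exists_rightTip {W : WSeq X} (hr : W.rank < ν) (hW : G.IsWalk W) (hR : W.RInf) :
    ∃ y, G.RightTip y W := by
  rcases W with b | ⟨r, lo, hi, x, P⟩
  · exact hR.elim
  cases hi with
  | some b => exact hR.elim
  | none =>
    obtain ⟨K, hK⟩ := exists_tail_isWalk hW
    obtain ⟨h1, h2⟩ := hK K le_rfl
    obtain ⟨y, hy, -⟩ := G.tip_partition _ h2 trivial hr
    exact ⟨y, K, h1, hy⟩

theorem exists_leftTip {W : WSeq X} (hr : W.rank < ν) (hW : G.IsWalk W) (hR : W.LInf) :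
    ∃ y, G.LeftTip y W :=
  exists_rightTip (by rwa [WSeq.rank_reverse]) hW.reverse hR

theorem exists_rightReach {W : WSeq X} {r : WRank} (hr : W.rank < r) (hrν : r ≤ ν)
    (hra : r ≠ WRank.arrow) (hW : G.IsWalk W) :
    ∃ y, G.RightReach y W ∧ G.rank y ≤ r := by
  by_cases hR : W.RInf
  · obtain ⟨y, hy⟩ := exists_rightTip (hr.trans_le hrν) hW hR
    refine ⟨y, rightReach_of_rightTip hy, ?_⟩
    rw [rank_of_rightTip hy]
    exact WRank.next_le_of_lt hr hra
  · rcases W with b | ⟨s, lo, hi, x, P⟩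
    · simp [PreWGraph.IsWalk] at hW
    cases hi with
    | none => exact absurd trivial hR
    | some b =>
      refine ⟨x b, PreWGraph.Linked.refl _, (hW.core.rank_le b ⟨?_, by simp⟩).trans hr.le⟩
      exact fun a ha => hW.core.le a ha b rfl

theorem exists_leftReach {W : WSeq X} {r : WRank} (hr : W.rank < r) (hrν : r ≤ ν)
    (hra : r ≠ WRank.arrow) (hW : G.IsWalk W) :
    ∃ y, G.LeftReach y W ∧ G.rank y ≤ r :=
  exists_rightReach (by rwa [WSeq.rank_reverse]) hrν hra hW.reverse

end WGraph

/-! ### Joining walks -/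

/-- The sequence that agrees with `f` below `k` and with `g` from `k` on. -/
def glue {α : Type u} (k : ℤ) (f g : ℤ → α) (m : ℤ) : α := if m < k then f m else g m

theorem glue_of_lt {α : Type u} {k m : ℤ} {f g : ℤ → α} (h : m < k) : glue k f g m = f m := if_pos h

theorem glue_of_le {α : Type u} {k m : ℤ} {f g : ℤ → α} (h : k ≤ m) : glue k f g m = g m :=
  if_neg (not_lt.2 h)

namespace PreWGraph

variable {X : Type u} {G : PreWGraph X} {r : WRank} {lo hi : Option ℤ} {x z : ℤ → X}
  {P Q : ℤ → WSeq X}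

/-- Outside rank arrow `ω` a nonterminal wnode has rank `r`, so exchanging adjacent pieces is
harmless if wtips in wnodes of rank `r` are kept. Hence the last two clauses of `Bridging`. -/
theorem NodeOK.imp {p q p' q' : WSeq X} {a : X} (h : G.NodeOK r p a q) (hr : r ≠ WRank.arrow)
    (hp : G.rank a = r → G.RightTip a p → G.RightTip a p')
    (hq : G.rank a = r → G.LeftTip a q → G.LeftTip a q') : G.NodeOK r p' a q' := fun h0 => by
  obtain ⟨h1, h2⟩ := h h0
  exact ⟨h1.imp (hp (h2 hr)) (hq (h2 hr)), h2⟩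

theorem Core.concat {k : ℤ} (hA : G.Core r lo (some k) x P) (hB : G.Core r (some k) hi z Q)
    (hxz : x k = z k) (hn : InnerIdx lo hi k → G.NodeOK r (P (k - 1)) (x k) (Q k)) :
    G.Core r lo hi (glue k x z) (glue k P Q) where
  le a ha b hb := (hA.le a ha k rfl).trans (hB.le k rfl b hb)
  rank_le m hm := by
    rcases lt_or_ge m k with h | h
    · rw [glue_of_lt h]
      exact hA.rank_le m ⟨hm.1, by simpa using h.le⟩
    · rw [glue_of_le h]
      exact hB.rank_le m ⟨by simpa using h, hm.2⟩
  piece m hm := by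
    rcases lt_or_ge m k with h | h
    · have hp := hA.piece m ⟨hm.1, by simpa using h⟩
      rw [glue_of_lt h, glue_of_lt h]
      rcases lt_or_ge (m + 1) k with h' | h'
      · rwa [glue_of_lt h']
      · obtain rfl : m + 1 = k := by omega
        rwa [glue_of_le le_rfl, ← hxz]
    · rw [glue_of_le h, glue_of_le h, glue_of_le (by omega)]
      exact hB.piece m ⟨by simpa using h, hm.2⟩
  node m hm := by
    rcases lt_trichotomy m k with h | rfl | h
    · rw [glue_of_lt h, glue_of_lt h, glue_of_lt (by omega)]
      exact hA.node m ⟨hm.1, by simpa using h⟩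
    · rw [glue_of_le le_rfl, glue_of_le le_rfl, glue_of_lt (by omega), ← hxz]
      exact hn hm
    · rw [glue_of_le h.le, glue_of_le h.le, glue_of_le (by omega)]
      exact hB.node m ⟨by simpa using h, hm.2⟩

theorem nodeIdx_shift {lo hi : Option ℤ} {s m : ℤ} :
    NodeIdx (lo.map (· + s)) (hi.map (· + s)) m ↔ NodeIdx lo hi (m - s) := by
  unfold NodeIdx
  cases lo <;> cases hi <;> simp <;> omega

theorem pieceIdx_shift {lo hi : Option ℤ} {s m : ℤ} :
    PieceIdx (lo.map (· + s)) (hi.map (· + s)) m ↔ PieceIdx lo hi (m - s) := by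
  unfold PieceIdx
  cases lo <;> cases hi <;> simp <;> omega

theorem innerIdx_shift {lo hi : Option ℤ} {s m : ℤ} :
    InnerIdx (lo.map (· + s)) (hi.map (· + s)) m ↔ InnerIdx lo hi (m - s) := by
  unfold InnerIdx
  cases lo <;> cases hi <;> simp <;> omega

theorem Core.shift (h : G.Core r lo hi x P) (s : ℤ) :
    G.Core r (lo.map (· + s)) (hi.map (· + s)) (fun m => x (m - s)) fun m => P (m - s) where
  le := by
    have := h.le
    cases lo <;> cases hi <;> simp at this ⊢
    exact this
  rank_le m hm := h.rank_le _ (nodeIdx_shift.1 hm)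
  piece m hm := by
    have := h.piece _ (pieceIdx_shift.1 hm)
    rwa [show m - s + 1 = m + 1 - s by ring] at this
  node m hm := by
    have := h.node _ (innerIdx_shift.1 hm)
    rwa [show m - s - 1 = m - 1 - s by ring] at this

theorem Core.single {a b : X} {p : WSeq X} (h : G.PieceOK r a p b) (ha : G.rank a ≤ r)
    (hb : G.rank b ≤ r) (k : ℤ) :
    G.Core r (some k) (some (k + 1)) (fun m => if m ≤ k then a else b) fun _ => p where
  le := by simp
  rank_le m _ := by
    show G.rank (if m ≤ k then a else b) ≤ r
    split_ifs <;> assumption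
  piece m hm := by
    have h1 := hm.1 k rfl
    have h2 := hm.2 _ rfl
    obtain rfl : m = k := by omega
    simpa using h
  node m hm := by
    have h1 := hm.1 k rfl
    have h2 := hm.2 _ rfl
    omega

theorem Core.point {a : X} (ha : G.rank a ≤ r) (k : ℤ) (x : ℤ → X) (hx : x k = a)
    (P : ℤ → WSeq X) : G.Core r (some k) (some k) x P where
  le := by simp
  rank_le m hm := by
    have h1 := hm.1 k rfl
    have h2 := hm.2 _ rfl
    obtain rfl : m = k := by omega
    rwa [hx]
  piece m hm := by
    have h1 := hm.1 k rfl
    have h2 := hm.2 _ rfl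
    omega
  node m hm := by
    have h1 := hm.1 k rfl
    have h2 := hm.2 _ rfl
    omega

theorem pieceOK_iff {a b : X} {p : WSeq X} (hr : r ≠ 0) : G.PieceOK r a p b ↔
    G.IsWalk p ∧ p.Nontrivial ∧ p.rank < r ∧ G.LeftReach a p ∧ G.RightReach b p := by
  rw [PieceOK, if_neg hr]

end PreWGraph

/-! ### Bridging and composition of walks in natural-number ranks -/

namespace WGraph

variable {X : Type u} {ν : WRank} {G : WGraph X ν}

theorem leftTip_of_agree {r : WRank} {hi hi' : Option ℤ} {x x' : ℤ → X} {P P' : ℤ → WSeq X}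
    {u : X} (hu : G.LeftTip u (.seq r none hi x P)) (hw : G.IsWalk (.seq r none hi' x' P'))
    (N s : ℤ) (hx : ∀ m < N, x m = x' (m + s)) (hP : ∀ m < N, P m = P' (m + s)) :
    G.LeftTip u (.seq r none hi' x' P') := by
  have h2 := hw.reverse
  simp only [PreWGraph.LeftTip, WSeq.reverse] at hu h2 ⊢
  refine rightTip_of_agree hu h2 (-N) (-s) (fun m hm => ?_) fun m hm => ?_
  · rw [hx _ (by omega)]
    congr 1
    ring
  · rw [hP _ (by omega)]
    congr 2
    ring

theorem leftReach_of_agree {r : WRank} {lo hi hi' : Option ℤ} {x x' : ℤ → X} {P P' : ℤ → WSeq X}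
    {u : X} (s : ℤ) (hu : G.LeftReach u (.seq r lo hi x P))
    (hw : G.IsWalk (.seq r (lo.map (· + s)) hi' x' P'))
    (N : ℤ) (hx : ∀ m < N, x m = x' (m + s)) (hP : ∀ m < N, P m = P' (m + s))
    (hb : ∀ b ∈ lo, x b = x' (b + s)) :
    G.LeftReach u (.seq r (lo.map (· + s)) hi' x' P') := by
  cases lo with
  | some b =>
    have h := hb b rfl
    simp only [Option.map_some, PreWGraph.LeftReach, WSeq.reverse, PreWGraph.RightReach,
      neg_neg] at hu ⊢
    rwa [← h]
  | none =>
    obtain ⟨y, h1, h2⟩ := hu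
    exact ⟨y, h1, leftTip_of_agree h2 hw N s hx hP⟩

/-- Any two consecutive pieces of `r`-walks that reach linked wnodes can be replaced by at most
three pieces of an `r`-walk. -/
def Bridging (G : WGraph X ν) (r : WRank) : Prop :=
  ∀ (a y y' c : X) (p q : WSeq X), G.PieceOK r a p y → G.PieceOK r y' q c → G.Linked y y' →
    G.rank a ≤ r → G.rank y ≤ r → G.rank y' ≤ r → G.rank c ≤ r →
    ∃ (k : ℤ) (d : ℤ → X) (R : ℤ → WSeq X), 1 ≤ k ∧ k ≤ 3 ∧ G.Core r (some 0) (some k) d R ∧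
      d 0 = a ∧ d k = c ∧ (∀ u, G.rank u = r → G.LeftTip u p → G.LeftTip u (R 0)) ∧
      ∀ u, G.rank u = r → G.RightTip u q → G.RightTip u (R (k - 1))

/-- The last piece of the first walk and the first piece of the second are cut off, and `k` bridging
pieces are inserted. The wnode at `h - 1` stays in place, while the wnode at `l + 1` of the second
walk moves to `h - 1 + k`; this determines `s`. -/
theorem Bridging.splice {r : WRank} (hbr : G.Bridging r) (hr : r ≠ WRank.arrow)
    {lo hi : Option ℤ} {h l : ℤ} {x z : ℤ → X} {P Q : ℤ → WSeq X}
    (hA : G.Core r lo (some h) x P) (hB : G.Core r (some l) hi z Q)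
    (hA1 : PieceIdx lo (some h) (h - 1)) (hB1 : PieceIdx (some l) hi l)
    (hl : G.Linked (x h) (z l)) :
    ∃ (k s : ℤ) (x' : ℤ → X) (P' : ℤ → WSeq X), 1 ≤ k ∧ k ≤ 3 ∧ s = h + k - (l + 2) ∧
      G.Core r lo (hi.map (· + s)) x' P' ∧
      (∀ m ≤ h - 1, x m = x' m) ∧ (∀ m < h - 1, P m = P' m) ∧
      (∀ m ≥ l + 1, z m = x' (m + s)) ∧ ∀ m ≥ l + 1, Q m = P' (m + s) := by
  have hp := hA.piece _ hA1
  have hq := hB.piece _ hB1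
  rw [sub_add_cancel] at hp
  have hlo : ∀ a ∈ lo, a ≤ h - 1 := hA1.1
  have hhi : ∀ b ∈ hi, l + 1 ≤ b := fun b hb => hB1.2 b hb
  obtain ⟨k, d, R, hk1, hk3, hD, hd0, hdk, hLT, hRT⟩ := hbr _ _ _ _ _ _ hp hq hl
    (hA.rank_le _ ⟨hlo, by simp⟩) (hA.rank_le _ ⟨fun a ha => (hlo a ha).trans (by omega), by simp⟩)
    (hB.rank_le _ ⟨by simp, fun b hb => le_trans (by omega) (hhi b hb)⟩)
    (hB.rank_le _ ⟨by simp, hhi⟩)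
  have hA' : G.Core r lo (some (h - 1)) x P :=
    hA.restrict (by simpa using hlo) (fun a ha => ⟨a, ha, le_rfl⟩) (by simp)
  have hB' : G.Core r (some (l + 1)) hi z Q :=
    hB.restrict (by simpa using hhi) (by simp) (fun a ha => ⟨a, ha, le_rfl⟩)
  have hD' := hD.shift (h - 1)
  have hB'' := hB'.shift (h + k - (l + 2))
  simp only [Option.map_some, zero_add] at hD' hB''
  have e1 : k + (h - 1) = h - 1 + k := by ring
  have e2 : l + 1 + (h + k - (l + 2)) = h - 1 + k := by ring
  rw [e1] at hD'
  rw [e2] at hB''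
  have hDB := hD'.concat hB'' (by
    have e3 : h - 1 + k - (h - 1) = k := by ring
    have e4 : h - 1 + k - (h + k - (l + 2)) = l + 1 := by ring
    simp only [e3, e4]
    exact hdk) (by
    intro hin
    have e3 : h - 1 + k - (h - 1) = k := by ring
    have e4 : h - 1 + k - (h + k - (l + 2)) = l + 1 := by ring
    have e5 : h - 1 + k - 1 - (h - 1) = k - 1 := by ring
    simp only [e3, e4, e5, hdk]
    have := hB.node (l + 1) ⟨by simp, fun b hb => by
      have := hin.2 _ (Option.mem_map_of_mem _ hb)
      omega⟩
    rw [add_sub_cancel_right] at this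
    exact this.imp hr (hRT _) fun _ => id)
  have hADB := hA'.concat hDB (by
    rw [glue_of_lt (by omega), sub_self, hd0]) (by
    intro hin
    rw [glue_of_lt (by omega), sub_self]
    have := hA.node (h - 1) ⟨hin.1, by simp⟩
    exact this.imp hr (fun _ => id) (hLT _))
  refine ⟨k, _, _, _, hk1, hk3, rfl, hADB, fun m hm => ?_, fun m hm => ?_, fun m hm => ?_,
    fun m hm => ?_⟩
  · rcases hm.lt_or_eq with hm | rfl
    · rw [glue_of_lt hm]
    · rw [glue_of_le le_rfl, glue_of_lt (by omega), sub_self, hd0]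
  · rw [glue_of_lt hm]
  · rw [glue_of_le (by omega), glue_of_le (by omega), add_sub_cancel_right]
  · rw [glue_of_le (by omega), glue_of_le (by omega), add_sub_cancel_right]

/-- A nontrivial walk of rank at most `r` that is not infinite to the right in rank `r` yields an
`r`-walk. -/
theorem exists_promote {r : WRank} (hrν : r ≤ ν) (hra : r ≠ WRank.arrow) {W : WSeq X}
    (hW : G.IsWalk W) (hn : W.Nontrivial) (hr : W.rank ≤ r) (hinf : ¬ (W.rank = r ∧ W.RInf)) :
    ∃ (lo : Option ℤ) (h : ℤ) (x : ℤ → X) (P : ℤ → WSeq X), G.Core r lo (some h) x P ∧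
      PieceIdx lo (some h) (h - 1) ∧ (∀ y, G.RightReach y W → G.Linked (x h) y) ∧
      (∀ y, G.LeftReach y W → G.LeftReach y (.seq r lo (some h) x P)) ∧
      (∀ u, r < G.rank u → G.LeftTip u W → G.LeftTip u (.seq r lo (some h) x P)) ∧
      (lo = none → W.rank = r ∧ W.LInf) := by
  rcases hr.lt_or_eq with hr | hr
  · obtain ⟨a, ha, har⟩ := exists_leftReach hr hrν hra hW
    obtain ⟨b, hb, hbr⟩ := exists_rightReach hr hrν hra hW
    have h0 : r ≠ 0 := fun h => not_lt_zero (h ▸ hr)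
    have hp : G.PieceOK r a W b := (PreWGraph.pieceOK_iff h0).2 ⟨hW, hn, hr, ha, hb⟩
    refine ⟨_, _, _, _, PreWGraph.Core.single hp har hbr 0, by simp [PieceIdx], fun y hy => ?_,
      fun y hy => ?_, fun u hu hu' => ?_, by simp⟩
    · simpa using rightReach_unique (hr.trans_le hrν) hW hb hy
    · simpa [PreWGraph.LeftReach, WSeq.reverse, PreWGraph.RightReach] using
        leftReach_unique (hr.trans_le hrν) hW ha hy
    -- A wtip of `W` lies in a wnode of rank at most `r`, so this clause is vacuous when `W` becomes
    -- a single piece.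
    · rw [rank_of_leftTip hu'] at hu
      exact absurd (WRank.next_le_of_lt hr hra) (not_le.2 hu)
  · rcases W with b | ⟨r', lo, hi, x, P⟩
    · simp [PreWGraph.IsWalk] at hW
    obtain rfl : r' = r := hr
    cases hi with
    | none => exact absurd ⟨rfl, trivial⟩ hinf
    | some h =>
      obtain ⟨m, hm⟩ := hn
      have hmh : m < h := hm.2 h rfl
      refine ⟨lo, h, x, P, hW.core, ⟨fun a ha => (hm.1 a ha).trans (by omega), by simp⟩,
        fun y hy => hy, fun y hy => hy, fun u _ hu => hu, ?_⟩
      rintro rfl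
      exact ⟨rfl, trivial⟩

/-- Walks of rank at most `n` that reach a common wnode can be composed to an `n`-walk. -/
def Composable (G : WGraph X ν) (n : WRank) : Prop :=
  ∀ (A B : WSeq X) (y : X), G.IsWalk A → G.IsWalk B → A.Nontrivial → B.Nontrivial →
    A.rank ≤ n → B.rank ≤ n → G.RightReach y A → G.LeftReach y B →
    ¬ (A.rank = n ∧ A.RInf) → ¬ (B.rank = n ∧ B.LInf) →
    ∃ M, G.IsWalk M ∧ M.Nontrivial ∧ M.rank = n ∧
      (∀ z, G.LeftReach z A → G.LeftReach z M) ∧ (∀ z, G.RightReach z B → G.RightReach z M) ∧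
      (∀ u, n < G.rank u → G.LeftTip u A → G.LeftTip u M) ∧
      (∀ u, n < G.rank u → G.RightTip u B → G.RightTip u M) ∧
      (M.LInf → A.rank = n ∧ A.LInf) ∧ (M.RInf → B.rank = n ∧ B.RInf)

/-- Both walks become `n`-walks with a terminal wnode at the junction: a walk of smaller rank is
taken as a single piece, even if it is infinite there. `B` is treated through its reversal, and the
results are spliced. -/
theorem Bridging.composable {n : WRank} (hbr : G.Bridging n) (hn : n ≤ ν) (hna : n ≠ WRank.arrow) :
    G.Composable n := by
  intro A B y hA hB hA1 hB1 hAn hBn hAy hBy hAi hBi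
  obtain ⟨lo, h, x, P, hc, hpi, hlink, hreach, htip, hinf⟩ :=
    exists_promote hn hna hA hA1 hAn hAi
  obtain ⟨lo2, h2, x2, P2, hc2, hpi2, hlink2, hreach2, htip2, hinf2⟩ :=
    exists_promote hn hna hB.reverse (WSeq.nontrivial_reverse.2 hB1) (by rwa [WSeq.rank_reverse])
      (by rwa [WSeq.rank_reverse])
  have hc2' := hc2.reverse
  have hl : G.Linked (x h) (x2 (-(-h2))) := by
    rw [neg_neg]
    exact Linked.trans (hlink y hAy) (hlink2 y hBy).symm
  obtain ⟨k, s, x', P', hk1, hk3, hs, hM, hx, hP, hz, hQ⟩ := hbr.splice hna hc hc2' hpi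
    (by
      rw [← Option.map_some, pieceIdx_neg]
      convert hpi2 using 1
      ring) hl
  have hMw := hM.isWalk hna
  refine ⟨_, hMw, ⟨h - 1, fun a ha => hpi.1 a ha, ?_⟩, rfl, fun z hz' => ?_, fun z hz' => ?_,
    fun u hu hu' => ?_, fun u hu hu' => ?_, fun hL => ?_, fun hR => ?_⟩
  · cases lo2 with
    | none => simp
    | some b =>
      have := hpi2.1 b rfl
      simp
      omega
  · have := leftReach_of_agree (lo := lo) (hi' := (lo2.map Neg.neg).map (· + s)) (x' := x')
      (P' := P') 0 (hreach z hz') (by simpa using hMw) (h - 1)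
      (fun m hm => by rw [add_zero]; exact hx m hm.le) (fun m hm => by rw [add_zero]; exact hP m hm)
      (fun b hb => by rw [add_zero]; exact hx b (hpi.1 b hb))
    simpa using this
  · have h1 := hreach2 z (PreWGraph.leftReach_reverse.2 hz')
    refine rightReach_of_agree (lo := some (-h2)) (x := fun m => x2 (-m))
      (P := fun m => (P2 (-1 - m)).reverse) s h1 hMw (-h2) (fun m hm => hz m (by omega))
      (fun m hm => hQ m (by omega)) fun b hb => hz b ?_
    cases lo2 with
    | none => simp at hb
    | some a =>
      have := hpi2.1 a rfl
      simp at hb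
      omega
  · have h1 := htip u hu hu'
    cases lo with
    | some a => exact h1.elim
    | none =>
      exact leftTip_of_agree h1 hMw (h - 1) 0 (fun m hm => by rw [add_zero]; exact hx m hm.le)
        (fun m hm => by rw [add_zero]; exact hP m hm)
  · have h1 := htip2 u hu (PreWGraph.leftTip_reverse.2 hu')
    cases lo2 with
    | some a => exact h1.elim
    | none =>
      exact rightTip_of_agree (lo := some (-h2)) (x := fun m => x2 (-m))
        (P := fun m => (P2 (-1 - m)).reverse) h1 hMw (-h2) s
        (fun m hm => hz m (by omega)) (fun m hm => hQ m (by omega))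
  · apply hinf
    cases lo with
    | none => rfl
    | some a => exact hL.elim
  · have := hinf2 (by
      cases lo2 with
      | none => rfl
      | some a => exact hR.elim)
    rwa [WSeq.rank_reverse, WSeq.LInf, WSeq.reverse_reverse] at this

/-- The wnode `u` that contains the traversed wtip is linked to both ends and is an admissible
nonterminal wnode, so `p` and `q` are kept unchanged and meet at `u`. -/
theorem bridging_of_tip {r : WRank} {a y y' c u : X} {p q : WSeq X} (hr0 : r ≠ 0)
    (hp : G.PieceOK r a p y) (hq : G.PieceOK r y' q c) (hy : G.Linked u y) (hy' : G.Linked u y')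
    (ha : G.rank a ≤ r) (hc : G.rank c ≤ r) (hu : G.rank u = r)
    (ht : G.RightTip u p ∨ G.LeftTip u q) :
    ∃ (k : ℤ) (d : ℤ → X) (R : ℤ → WSeq X), 1 ≤ k ∧ k ≤ 3 ∧ G.Core r (some 0) (some k) d R ∧
      d 0 = a ∧ d k = c ∧ (∀ u, G.rank u = r → G.LeftTip u p → G.LeftTip u (R 0)) ∧
      ∀ u, G.rank u = r → G.RightTip u q → G.RightTip u (R (k - 1)) := by
  rw [PreWGraph.pieceOK_iff hr0] at hp hq
  obtain ⟨hp1, hp2, hp3, hp4, hp5⟩ := hp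
  obtain ⟨hq1, hq2, hq3, hq4, hq5⟩ := hq
  have h1 : G.PieceOK r a p u :=
    (PreWGraph.pieceOK_iff hr0).2 ⟨hp1, hp2, hp3, hp4, RightReach.linked hp5 hy.symm⟩
  have h2 : G.PieceOK r u q c :=
    (PreWGraph.pieceOK_iff hr0).2 ⟨hq1, hq2, hq3, LeftReach.linked hq4 hy'.symm, hq5⟩
  have h3 := (PreWGraph.Core.single h1 ha hu.le 0).concat (PreWGraph.Core.single h2 hu.le hc (0 + 1))
    (by simp) (fun _ _ => ⟨by simpa using ht, fun _ => by simpa using hu⟩)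
  exact ⟨2, _, _, by norm_num, by norm_num, h3, by simp [glue], by simp [glue],
    fun u _ h => by simpa [glue] using h, fun u _ h => by simpa [glue] using h⟩

theorem bridging_of_composite {r : WRank} {a c : X} {p q M : WSeq X} (hr0 : r ≠ 0)
    (hM1 : G.IsWalk M) (hM2 : M.Nontrivial) (hM3 : M.rank < r) (hM4 : G.LeftReach a M)
    (hM5 : G.RightReach c M) (ha : G.rank a ≤ r) (hc : G.rank c ≤ r)
    (hL : ∀ u, G.rank u = r → G.LeftTip u p → G.LeftTip u M)
    (hR : ∀ u, G.rank u = r → G.RightTip u q → G.RightTip u M) :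
    ∃ (k : ℤ) (d : ℤ → X) (R : ℤ → WSeq X), 1 ≤ k ∧ k ≤ 3 ∧ G.Core r (some 0) (some k) d R ∧
      d 0 = a ∧ d k = c ∧ (∀ u, G.rank u = r → G.LeftTip u p → G.LeftTip u (R 0)) ∧
      ∀ u, G.rank u = r → G.RightTip u q → G.RightTip u (R (k - 1)) :=
  ⟨1, _, _, le_rfl, by norm_num, PreWGraph.Core.single
    ((PreWGraph.pieceOK_iff hr0).2 ⟨hM1, hM2, hM3, hM4, hM5⟩) ha hc 0, by simp, by simp, hL, hR⟩

theorem bridging_zero : G.Bridging 0 := by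
  intro a y y' c p q hp hq hl ha hy hy' hc
  have h0 : ∀ {w : X}, G.rank w ≤ 0 → G.rank w = 0 := fun h => le_antisymm h zero_le
  obtain rfl := eq_of_linked G hl ((h0 hy).trans (h0 hy').symm)
  have h3 := (PreWGraph.Core.single hp ha hy 0).concat (PreWGraph.Core.single hq hy hc (0 + 1))
    (by simp) (fun _ h => absurd rfl h)
  exact ⟨2, _, _, by norm_num, by norm_num, h3, by simp [glue], by simp [glue],
    fun u _ h => by simpa [glue] using h, fun u _ h => by simpa [glue] using h⟩

/-- If `p` or `q` traverses a wtip of rank `n` at the junction, the wnode of that wtip has rank `n +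
1` and can be the nonterminal wnode. Otherwise the hypotheses of `Composable` hold and one `n`-walk
replaces both pieces. -/
theorem Composable.bridging_succ {n : ℕ} (hn : G.Composable (WRank.nat n)) :
    G.Bridging (WRank.nat (n + 1)) := by
  intro a y y' c p q hp hq hl ha hy hy' hc
  have hr0 : WRank.nat (n + 1) ≠ 0 := fun h => Nat.succ_ne_zero n (WRank.nat_injective h)
  have hp' := (PreWGraph.pieceOK_iff hr0).1 hp
  have hq' := (PreWGraph.pieceOK_iff hr0).1 hq
  obtain ⟨hp1, hp2, hp3, hp4, hp5⟩ := hp'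
  obtain ⟨hq1, hq2, hq3, hq4, hq5⟩ := hq'
  have hle : ∀ {r : WRank}, r < WRank.nat (n + 1) → r ≤ WRank.nat n := fun h => by
    obtain ⟨m, hm, rfl⟩ := WRank.exists_nat_of_lt_nat h
    exact WRank.nat_le_nat.2 (by omega)
  by_cases hpi : p.rank = WRank.nat n ∧ p.RInf
  · obtain ⟨u, hu1, hu2⟩ := exists_rightTip_of_rightReach hp5 hpi.2
    refine bridging_of_tip hr0 hp hq hu1 (Linked.trans hu1 hl) ha hc ?_ (Or.inl hu2)
    rw [rank_of_rightTip hu2, hpi.1, WRank.next_nat]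
  by_cases hqi : q.rank = WRank.nat n ∧ q.LInf
  · obtain ⟨u, hu1, hu2⟩ := exists_rightTip_of_rightReach hq4 hqi.2
    refine bridging_of_tip hr0 hp hq (Linked.trans hu1 hl.symm) hu1 ha hc ?_ (Or.inr hu2)
    rw [rank_of_leftTip hu2, hqi.1, WRank.next_nat]
  obtain ⟨M, hM1, hM2, hM3, hM4, hM5, hM6, hM7, -, -⟩ := hn p q y' hp1 hq1 hp2 hq2 (hle hp3)
    (hle hq3) (RightReach.linked hp5 hl) hq4 hpi hqi
  have hlt : WRank.nat n < WRank.nat (n + 1) := WRank.nat_lt_nat.2 (Nat.lt_succ_self n)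
  exact bridging_of_composite hr0 hM1 hM2 (hM3 ▸ hlt) (hM4 _ hp4) (hM5 _ hq5) ha hc
    (fun u hu => hM6 u (hu ▸ hlt)) (fun u hu => hM7 u (hu ▸ hlt))

theorem bridging_nat (n : ℕ) (hn : WRank.nat n ≤ ν) : G.Bridging (WRank.nat n) := by
  induction n with
  | zero => exact bridging_zero
  | succ n ih =>
    have h : WRank.nat n ≤ ν := (WRank.nat_le_nat.2 (Nat.le_succ n)).trans hn
    exact ((ih h).composable h (WRank.nat_ne_arrow n)).bridging_succ

theorem composable_nat (n : ℕ) (hn : WRank.nat n ≤ ν) : G.Composable (WRank.nat n) :=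
  (bridging_nat n hn).composable hn (WRank.nat_ne_arrow n)

end WGraph

/-! ### Walks of rank arrow `ω` -/

namespace WGraph

variable {X : Type u} {G : WGraph X ⊤}

theorem arrow_ne_zero : WRank.arrow ≠ 0 := (WRank.nat_ne_arrow 0).symm

/-- A left part of a walk of rank arrow `ω` along which the ranks strictly decrease, or a single
wnode. -/
structure Half (G : WGraph X ⊤) (lo : Option ℤ) (x : ℤ → X) (P : ℤ → WSeq X) : Prop where
  core : G.Core WRank.arrow lo (some 0) x P
  lo_eq : lo = none ∨ lo = some 0
  anti : ∀ m < 0, lo = none → G.rank (x (m + 1)) < G.rank (x m) ∧ (P m).rank < G.rank (x m)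

theorem Half.isWalk {x : ℤ → X} {P : ℤ → WSeq X} (h : Half G none x P) :
    G.IsWalk (.seq WRank.arrow none (some 0) x P) := by
  refine PreWGraph.isWalk_iff.2 ⟨h.core, fun _ => ⟨Or.inl rfl, 0, by simp, by simp, fun m hm => ?_⟩⟩
  have h1 := hm.2 0 rfl
  exact ⟨fun h => by omega, fun _ => h.anti m h1 rfl⟩

/-- Everything that the walk `W` reaches on its left is reached on its left by `V`. -/
def LeftKeeps (G : WGraph X ⊤) (W V : WSeq X) : Prop :=
  (∀ z, G.LeftReach z W → G.LeftReach z V) ∧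
    ∀ u, G.rank u = ⊤ → G.LeftTip u W → G.LeftTip u V

theorem LeftKeeps.trans {U V W : WSeq X} (h1 : LeftKeeps G U V) (h2 : LeftKeeps G V W) :
    LeftKeeps G U W :=
  ⟨fun z hz => h2.1 z (h1.1 z hz), fun u hu hz => h2.2 u hu (h1.2 u hu hz)⟩

theorem leftKeeps_of_agree {r : WRank} {hi hi' : Option ℤ} {x x' : ℤ → X} {P P' : ℤ → WSeq X}
    (hw : G.IsWalk (.seq r none hi' x' P'))
    (N s : ℤ) (hx : ∀ m < N, x m = x' (m + s)) (hP : ∀ m < N, P m = P' (m + s)) :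
    LeftKeeps G (.seq r none hi x P) (.seq r none hi' x' P') := by
  refine ⟨?_, fun u _ hu => leftTip_of_agree hu hw N s hx hP⟩
  rintro z ⟨y, h1, h2⟩
  exact ⟨y, h1, leftTip_of_agree h2 hw N s hx hP⟩

/-- There is a walk that reaches on its left all that `W` reaches on its left, and on its right all
that `V` reaches on its left. -/
def Joinable (G : WGraph X ⊤) (W V : WSeq X) : Prop :=
  ∃ M, G.IsWalk M ∧ M.Nontrivial ∧ M.rank < ⊤ ∧ LeftKeeps G W M ∧ LeftKeeps G V M.reverse

theorem Joinable.symm {W V : WSeq X} (h : Joinable G W V) : Joinable G V W := by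
  obtain ⟨M, h1, h2, h3, h4, h5⟩ := h
  exact ⟨M.reverse, h1.reverse, WSeq.nontrivial_reverse.2 h2, by rwa [WSeq.rank_reverse], h5,
    by rwa [WSeq.reverse_reverse]⟩

theorem Joinable.mono {W V W' V' : WSeq X} (h : Joinable G W V) (hW : LeftKeeps G W' W)
    (hV : LeftKeeps G V' V) : Joinable G W' V' := by
  obtain ⟨M, h1, h2, h3, h4, h5⟩ := h
  exact ⟨M, h1, h2, h3, hW.trans h4, hV.trans h5⟩

/-- `M` becomes the piece with index `0`, the one whose rank `ArrowShape` leaves free, between the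
first half and the reversal of the second. The hypotheses `ht` and `ht'` provide the wtips at the
two ends of `M`. If both halves are single wnodes, `M` alone does the job, as a two-ended sequence
cannot have rank arrow `ω`. -/
theorem Half.joinable {lo lo' : Option ℤ} {x x' : ℤ → X} {P P' : ℤ → WSeq X} {M : WSeq X}
    (h : Half G lo x P) (h' : Half G lo' x' P') (hM : G.IsWalk M) (hM1 : M.Nontrivial)
    (hM2 : M.rank < WRank.arrow) (hL : G.LeftReach (x 0) M) (hR : G.RightReach (x' 0) M)
    (ht : (lo = some 0 ∨ G.RightTip (x 0) (P (-1))) ∨ G.LeftTip (x 0) M)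
    (ht' : (lo' = some 0 ∨ G.RightTip (x' 0) (P' (-1))) ∨ G.RightTip (x' 0) M) :
    Joinable G (.seq WRank.arrow lo (some 0) x P) (.seq WRank.arrow lo' (some 0) x' P') := by
  by_cases hboth : lo = some 0 ∧ lo' = some 0
  · obtain ⟨rfl, rfl⟩ := hboth
    refine ⟨M, hM, hM1, hM2.trans WRank.arrow_lt_top, ⟨fun z hz => ?_, fun u _ hu => hu.elim⟩,
      ⟨fun z hz => ?_, fun u _ hu => hu.elim⟩⟩
    · exact LeftReach.linked hL (by
        simpa [PreWGraph.LeftReach, WSeq.reverse, PreWGraph.RightReach] using hz)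
    · exact RightReach.linked (W := M.reverse.reverse) (by rwa [WSeq.reverse_reverse]) (by
        simpa [PreWGraph.LeftReach, WSeq.reverse, PreWGraph.RightReach] using hz)
  have hp : G.PieceOK WRank.arrow (x 0) M (x' 0) :=
    (PreWGraph.pieceOK_iff arrow_ne_zero).2 ⟨hM, hM1, hM2, hL, hR⟩
  have hx0 : ∀ {lo : Option ℤ} {x : ℤ → X} {P : ℤ → WSeq X}, Half G lo x P →
      G.rank (x 0) ≤ WRank.arrow := fun h => h.core.rank_le 0
    ⟨fun a ha => by rcases h.lo_eq with e | e <;> simp [e] at ha; omega, by simp⟩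
  have hs := PreWGraph.Core.single hp (hx0 h) (hx0 h') 0
  have hr := h'.core.reverse.shift 1
  simp only [Option.map_some, neg_zero, zero_add] at hs hr
  have h1 := hs.concat hr (by simp) (by
    intro hin _
    refine ⟨?_, fun h => absurd rfl h⟩
    rcases ht' with (rfl | ht') | ht'
    · have := hin.2 1 (by simp)
      omega
    · right
      simpa [PreWGraph.leftTip_reverse] using ht'
    · left
      simpa using ht')
  have h2 := h.core.concat h1 (by rw [glue_of_lt (by norm_num)]; simp) (by
    intro hin _
    refine ⟨?_, fun h => absurd rfl h⟩
    rcases ht with (rfl | ht) | ht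
    · have := hin.1 0 (by simp)
      omega
    · left
      simpa using ht
    · right
      rw [glue_of_lt (by norm_num)]
      exact ht)
  have hw := PreWGraph.isWalk_iff.2 ⟨h2, fun _ => by
    refine ⟨?_, 0, ?_, ?_, fun m hm => ⟨fun h0 => ?_, fun h0 => ?_⟩⟩
    · rcases h.lo_eq with rfl | rfl
      · exact Or.inl rfl
      · rcases h'.lo_eq with rfl | rfl
        · exact Or.inr rfl
        · simp at hboth
    · rcases h.lo_eq with rfl | rfl <;> simp
    · rcases h'.lo_eq with rfl | rfl <;> simp
    · rw [glue_of_le h0.le, glue_of_le (by omega), glue_of_le (by omega), glue_of_le (by omega),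
        glue_of_le (by omega), glue_of_le (by omega), WSeq.rank_reverse]
      have hlo' : lo' = none := by
        rcases h'.lo_eq with rfl | rfl
        · rfl
        · have := hm.2 1 (by simp)
          omega
      have := h'.anti (-m) (by omega) hlo'
      rw [show -(m - 1) = -m + 1 by ring, show -(m + 1 - 1) = -m by ring,
        show -1 - (m - 1) = -m by ring]
      exact this
    · have hlo : lo = none := by
        rcases h.lo_eq with rfl | rfl
        · rfl
        · have := hm.1 0 (by simp)
          omega
      have := h.anti m h0 hlo
      rw [glue_of_lt h0, glue_of_lt h0]
      rcases lt_or_ge (m + 1) 0 with h3 | h3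
      · rwa [glue_of_lt h3]
      · obtain rfl : m = -1 := by omega
        rw [glue_of_le h3, glue_of_lt (by norm_num)]
        exact this⟩
  refine ⟨_, hw, ⟨0, fun a ha => ?_, fun b hb => ?_⟩, WRank.arrow_lt_top, ?_, ?_⟩
  · rcases h.lo_eq with rfl | rfl <;> simp at ha
    omega
  · rcases h'.lo_eq with rfl | rfl <;> simp at hb
    omega
  · rcases h.lo_eq with rfl | rfl
    · refine leftKeeps_of_agree hw 0 0 (fun m hm => ?_) fun m hm => ?_
      · rw [add_zero, glue_of_lt hm]
      · rw [add_zero, glue_of_lt hm]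
    · refine ⟨fun z hz => ?_, fun u _ hu => hu.elim⟩
      simpa [PreWGraph.LeftReach, WSeq.reverse, PreWGraph.RightReach, glue] using hz
  · have hw' := hw.reverse
    simp only [WSeq.reverse] at hw' ⊢
    rcases h'.lo_eq with rfl | rfl
    · refine leftKeeps_of_agree hw' 0 (-1) (fun m hm => ?_) fun m hm => ?_
      · rw [glue_of_le (by omega), glue_of_le (by omega)]
        congr 1
        ring
      · rw [glue_of_le (by omega), glue_of_le (by omega), WSeq.reverse_reverse]
        congr 1
        ring
    · refine ⟨fun z hz => ?_, fun u _ hu => hu.elim⟩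
      simpa [PreWGraph.LeftReach, WSeq.reverse, PreWGraph.RightReach, glue] using hz

/-- On its right, where it reaches `y`, the walk can be extended by walks of natural-number rank. -/
def Flex (G : WGraph X ⊤) (W : WSeq X) (y : X) : Prop :=
  ∃ (lo : Option ℤ) (x : ℤ → X) (P : ℤ → WSeq X) (T : WSeq X) (t : ℕ), Half G lo x P ∧
    (lo = some 0 ∨ G.RightTip (x 0) (P (-1))) ∧ G.IsWalk T ∧ T.Nontrivial ∧ T.rank = WRank.nat t ∧
    G.LeftReach (x 0) T ∧ G.RightReach y T ∧ LeftKeeps G W (.seq WRank.arrow lo (some 0) x P)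

/-- On its right, where it reaches `y`, the walk can be extended by walks of any natural-number rank
`N`, though only by a change of a part that depends on `N`. -/
def Stiff (G : WGraph X ⊤) (W : WSeq X) (y : X) : Prop :=
  ∀ N : ℕ, ∃ (x : ℤ → X) (P : ℤ → WSeq X) (T : WSeq X) (t : ℕ), N < t ∧ Half G none x P ∧
    G.IsWalk T ∧ T.Nontrivial ∧ T.rank = WRank.nat t ∧ G.rank (x 0) = WRank.nat (t + 1) ∧
    G.LeftTip (x 0) T ∧ ¬ T.RInf ∧ G.RightReach y T ∧
    LeftKeeps G W (.seq WRank.arrow none (some 0) x P)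

theorem Flex.joinable {W V : WSeq X} {y : X} (hW : Flex G W y) (hV : Flex G V y) :
    Joinable G W V := by
  obtain ⟨lo, x, P, T, t, h1, h2, h3, h4, h5, h6, h7, h8⟩ := hW
  obtain ⟨lo', x', P', T', t', h1', h2', h3', h4', h5', h6', h7', h8'⟩ := hV
  -- Composing in a rank above both excludes infinite ends of that rank. The rank may grow freely
  -- because the wnodes at the ends of `M` need no wtip of `M`.
  have hlt : t < max t t' + 1 ∧ t' < max t t' + 1 := by omega
  obtain ⟨M, hM1, hM2, hM3, hM4, hM5, -⟩ := composable_nat (G := G) (max t t' + 1) le_top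
    T T'.reverse y h3 h3'.reverse h4 (WSeq.nontrivial_reverse.2 h4')
    (by rw [h5]; exact WRank.nat_le_nat.2 hlt.1.le)
    (by rw [WSeq.rank_reverse, h5']; exact WRank.nat_le_nat.2 hlt.2.le) h7
    (PreWGraph.leftReach_reverse.2 h7')
    (fun h => by rw [h5] at h; exact hlt.1.ne (WRank.nat_injective h.1))
    (fun h => by rw [WSeq.rank_reverse, h5'] at h; exact hlt.2.ne (WRank.nat_injective h.1))
  refine (Half.joinable h1 h1' hM1 hM2 (hM3 ▸ WRank.nat_lt_arrow _) (hM4 _ h6) (hM5 _ ?_)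
    (Or.inl h2) (Or.inl h2')).mono h8 h8'
  rw [← PreWGraph.leftReach_reverse, WSeq.reverse_reverse]
  exact h6'

/-- `M` is appended as the new last piece. The wtip required at the old end is the one that `M`
traverses on its left; the shift by `-1` puts `w` at index `0`. -/
theorem Half.extend {x : ℤ → X} {P : ℤ → WSeq X} {M : WSeq X} {w : X} {s : ℕ}
    (h : Half G none x P) (hM : G.IsWalk M) (hM1 : M.Nontrivial)
    (hM2 : M.rank = WRank.nat s) (hx : G.rank (x 0) = WRank.nat (s + 1))
    (ht : G.LeftTip (x 0) M) (hR : G.RightReach w M) (hw : G.rank w < G.rank (x 0)) :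
    ∃ x' P', Half G none x' P' ∧ x' 0 = w ∧
      LeftKeeps G (.seq WRank.arrow none (some 0) x P) (.seq WRank.arrow none (some 0) x' P') := by
  have hp : G.PieceOK WRank.arrow (x 0) M w :=
    (PreWGraph.pieceOK_iff arrow_ne_zero).2
      ⟨hM, hM1, hM2 ▸ WRank.nat_lt_arrow s, leftReach_of_leftTip ht, hR⟩
  have hx' : G.rank (x 0) ≤ WRank.arrow := hx ▸ (WRank.nat_lt_arrow _).le
  have h1 := h.core.concat (PreWGraph.Core.single hp hx' (hw.le.trans hx') 0) (by simp)
    (fun _ _ => ⟨Or.inr ht, fun h => absurd rfl h⟩)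
  have h2 := h1.shift (-1)
  simp only [Option.map_none, Option.map_some, sub_neg_eq_add, zero_add, add_neg_cancel] at h2
  have h3 : Half G none _ _ := ⟨h2, Or.inl rfl, fun m hm _ => by
    rcases lt_or_ge (m + 1) 0 with h' | h'
    · have := h.anti (m + 1) h' rfl
      rw [glue_of_lt h', glue_of_lt h']
      rcases lt_or_ge (m + 1 + 1) 0 with h'' | h''
      · rwa [glue_of_lt h'']
      · obtain rfl : m = -2 := by omega
        rw [glue_of_le h'']
        simpa using this
    · obtain rfl : m = -1 := by omega
      have hs : M.rank < G.rank (x 0) := by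
        rw [hM2, hx]
        exact WRank.nat_lt_nat.2 (Nat.lt_succ_self s)
      simpa [glue] using ⟨hw, hs⟩⟩
  refine ⟨_, _, h3, by simp [glue], leftKeeps_of_agree h3.isWalk 0 (-1) (fun m hm => ?_)
    fun m hm => ?_⟩
  · rw [neg_add_cancel_right, glue_of_lt hm]
  · rw [neg_add_cancel_right, glue_of_lt hm]

theorem Stiff.joinable {W V : WSeq X} {y : X} (hW : Stiff G W y) (hV : Flex G V y ∨ Stiff G V y) :
    Joinable G W V := by
  have key : ∀ (lo' : Option ℤ) (x' : ℤ → X) (P' : ℤ → WSeq X) (T' : WSeq X) (t' : ℕ),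
      Half G lo' x' P' → G.IsWalk T' → T'.Nontrivial → T'.rank = WRank.nat t' →
      G.LeftReach (x' 0) T' → G.RightReach y T' →
      LeftKeeps G V (.seq WRank.arrow lo' (some 0) x' P') →
      ((lo' = some 0 ∨ G.RightTip (x' 0) (P' (-1))) ∨
        G.rank (x' 0) = WRank.nat (t' + 1) ∧ G.LeftTip (x' 0) T' ∧ ¬ T'.RInf) →
      Joinable G W V := by
    intro lo' x' P' T' t' h1' h3' h4' h5' h6' h7' h8' hd
    -- With `t` larger than `t'`, composing in rank `t` keeps the left wtip of `T`, on which `x 0`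
    -- depends, and `x 0` has larger rank than `x' 0` in the stiff case.
    obtain ⟨x, P, T, t, htt, h1, h3, h4, h5, hx, ht, hnr, h7, h8⟩ := hW (t' + 1)
    obtain ⟨M, hM1, hM2, hM3, hM4, hM5, hM6, -⟩ := composable_nat (G := G) t le_top
      T T'.reverse y h3 h3'.reverse h4 (WSeq.nontrivial_reverse.2 h4') h5.le
      (by rw [WSeq.rank_reverse, h5']; exact WRank.nat_le_nat.2 (by omega)) h7
      (PreWGraph.leftReach_reverse.2 h7') (fun h => hnr h.2)
      (fun h => by
        rw [WSeq.rank_reverse, h5'] at h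
        have := WRank.nat_injective h.1
        omega)
    have hMt : G.LeftTip (x 0) M := hM6 _ (hx ▸ WRank.nat_lt_nat.2 (Nat.lt_succ_self t)) ht
    have hMR : G.RightReach (x' 0) M := by
      apply hM5
      rw [← PreWGraph.leftReach_reverse, WSeq.reverse_reverse]
      exact h6'
    rcases hd with hd | ⟨hx', ht', hnr'⟩
    · exact (Half.joinable h1 h1' hM1 hM2 (hM3 ▸ WRank.nat_lt_arrow _) (leftReach_of_leftTip hMt)
        hMR (Or.inr hMt) (Or.inl hd)).mono h8 h8'
    -- Here `x' 0` needs the left wtip of `T'`, which `M` may lose. So `M` is used to extend the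
    -- first half as far as `x' 0`, and the middle walk is `E`, which is `T'` composed with its own
    -- reversal: it traverses wtips in `x' 0` at both ends.
    · obtain ⟨E, hE1, hE2, hE3, hE4, hE5, hE6, hE7, -⟩ := composable_nat (G := G) t' le_top
        T' T'.reverse y h3' h3'.reverse h4' (WSeq.nontrivial_reverse.2 h4') h5'.le
        (by rw [WSeq.rank_reverse, h5']) h7'
        (PreWGraph.leftReach_reverse.2 h7') (fun h => hnr' h.2)
        (fun h => hnr' (by simpa [WSeq.LInf, WSeq.reverse_reverse] using h.2))
      have hlt : WRank.nat t' < G.rank (x' 0) := hx' ▸ WRank.nat_lt_nat.2 (Nat.lt_succ_self t')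
      have hEt := hE6 _ hlt ht'
      have hEt' := hE7 (x' 0) hlt (by
        rw [← PreWGraph.leftTip_reverse, WSeq.reverse_reverse]
        exact ht')
      obtain ⟨x₁, P₁, h₁, hx₁, hk₁⟩ := h1.extend hM1 hM2 hM3 hx hMt hMR
        (by rw [hx, hx']; exact WRank.nat_lt_nat.2 (by omega))
      exact (Half.joinable h₁ h1' hE1 hE2 (hE3 ▸ WRank.nat_lt_arrow _)
        (hx₁ ▸ leftReach_of_leftTip hEt) (rightReach_of_rightTip hEt') (Or.inr (hx₁ ▸ hEt))
        (Or.inr hEt')).mono (h8.trans hk₁) h8'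
  rcases hV with ⟨lo, x, P, T, t, h1, h2, h3, h4, h5, h6, h7, h8⟩ | hV
  · exact key lo x P T t h1 h3 h4 h5 h6 h7 h8 (Or.inl h2)
  · obtain ⟨x, P, T, t, -, h1, h3, h4, h5, hx, ht, hnr, h7, h8⟩ := hV 0
    exact key none x P T t h1 h3 h4 h5 (leftReach_of_leftTip ht) h7 h8 (Or.inr ⟨hx, ht, hnr⟩)

theorem joinable_of_flex_or_stiff {W V : WSeq X} {y : X} (hW : Flex G W y ∨ Stiff G W y)
    (hV : Flex G V y ∨ Stiff G V y) : Joinable G W V := by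
  rcases hW with hW | hW
  · rcases hV with hV | hV
    · exact hW.joinable hV
    · exact (hV.joinable (Or.inl hW)).symm
  · exact hW.joinable hV

/-- Raising the rank by one makes every composition legitimate: pieces of rank at most `n` have no
infinite end of rank `n + 1`, and the composite does not acquire one. -/
theorem exists_composite {n : ℕ} {x : ℤ → X} {P : ℤ → WSeq X} (j : ℤ) (i : ℕ)
    (h : ∀ m, j ≤ m → m ≤ j + i → G.IsWalk (P m) ∧ (P m).Nontrivial ∧ (P m).rank ≤ WRank.nat n ∧
      G.LeftReach (x m) (P m) ∧ G.RightReach (x (m + 1)) (P m)) :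
    ∃ T, G.IsWalk T ∧ T.Nontrivial ∧ T.rank ≤ WRank.nat (n + 1) ∧ G.LeftReach (x j) T ∧
      G.RightReach (x (j + i + 1)) T ∧ ¬ (T.rank = WRank.nat (n + 1) ∧ T.LInf) ∧
      ¬ (T.rank = WRank.nat (n + 1) ∧ T.RInf) := by
  have hlt : WRank.nat n < WRank.nat (n + 1) := WRank.nat_lt_nat.2 (Nat.lt_succ_self n)
  induction i with
  | zero =>
    obtain ⟨h1, h2, h3, h4, h5⟩ := h j le_rfl (by simp)
    exact ⟨P j, h1, h2, h3.trans hlt.le, h4, by simpa using h5,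
      fun h => (h3.trans_lt hlt).ne h.1, fun h => (h3.trans_lt hlt).ne h.1⟩
  | succ i ih =>
    obtain ⟨T, t1, t2, t3, t4, t5, t6, t7⟩ := ih fun m hm hm' => h m hm (by push_cast; omega)
    obtain ⟨h1, h2, h3, h4, h5⟩ := h (j + i + 1) (by omega) (by push_cast; omega)
    obtain ⟨M, hM1, hM2, hM3, hM4, hM5, -, -, hM6, hM7⟩ := composable_nat (G := G) (n + 1) le_top
      T (P (j + i + 1)) _ t1 h1 t2 h2 t3 (h3.trans hlt.le) t5 h4 t7
      (fun h => (h3.trans_lt hlt).ne h.1)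
    refine ⟨M, hM1, hM2, hM3.le, hM4 _ t4, ?_, fun h => t6 (hM6 h.2),
      fun h => (h3.trans_lt hlt).ne (hM7 h.2).1⟩
    have := hM5 _ h5
    push_cast
    rwa [← add_assoc]

end WGraph

/-! ### Decomposition of walks of rank arrow `ω`, and bridging in rank `ω` -/

namespace WGraph

variable {X : Type u} {G : WGraph X ⊤}

theorem flex_of_nat {W : WSeq X} {y : X} {n : ℕ} (hW : G.IsWalk W) (hn : W.Nontrivial)
    (hr : W.rank = WRank.nat n) (hy : G.RightReach y W) : Flex G W y := by
  have hlt : W.rank < WRank.nat (n + 1) := hr ▸ WRank.nat_lt_nat.2 (Nat.lt_succ_self n)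
  obtain ⟨w, hw, hwr⟩ := exists_leftReach hlt le_top (WRank.nat_ne_arrow _) hW
  refine ⟨some 0, fun _ => w, fun _ => W, W, n, ⟨PreWGraph.Core.point
    (hwr.trans (WRank.nat_lt_arrow _).le) 0 _ rfl _, Or.inr rfl, fun m _ h => by simp at h⟩,
    Or.inl rfl, hW, hn, hr, hw, hy, fun z hz => ?_, fun u hu hu' => ?_⟩
  · simpa [PreWGraph.LeftReach, WSeq.reverse, PreWGraph.RightReach] using
      leftReach_unique (hr ▸ WRank.nat_lt_top n) hW hw hz
  · rw [rank_of_leftTip hu', hr, WRank.next_nat] at hu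
    exact absurd hu (WRank.nat_lt_top _).ne

/-- A walk of rank arrow `ω` with a last wnode `x h`, such that the ranks of the wnodes `x m`
with `m < h` are the strictly decreasing natural numbers `σ m`. -/
structure ArrowData (G : WGraph X ⊤) (h : ℤ) (x : ℤ → X) (P : ℤ → WSeq X) (σ : ℤ → ℕ) (N : ℕ) :
    Prop where
  core : G.Core WRank.arrow none (some h) x P
  rank_eq : ∀ m < h, G.rank (x m) = WRank.nat (σ m)
  anti : ∀ m < h - 1, σ (m + 1) < σ m
  piece_lt : ∀ m < h - 1, (P m).rank < WRank.nat (σ m)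
  last : (P (h - 1)).rank = WRank.nat N

theorem exists_arrowData {h : ℤ} {x : ℤ → X} {P : ℤ → WSeq X}
    (hW : G.IsWalk (.seq WRank.arrow none (some h) x P)) : ∃ σ N, ArrowData G h x P σ N := by
  obtain ⟨hc, hs⟩ := PreWGraph.isWalk_iff.1 hW
  obtain ⟨-, p, -, hp, hs⟩ := hs rfl
  have hp' := hp h rfl
  have hanti : ∀ m < h - 1, G.rank (x (m + 1)) < G.rank (x m) ∧ (P m).rank < G.rank (x m) :=
    fun m hm => (hs m ⟨by simp, by simp; omega⟩).2 (by omega)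
  have hnat : ∀ m, ∃ k, m < h → G.rank (x m) = WRank.nat k := by
    intro m
    -- The rank of `x m` lies strictly below that of `x (m - 1)`, which is at most arrow `ω`; so it
    -- is a natural number.
    by_cases hm : m < h
    · have h1 := (hanti (m - 1) (by omega)).1
      rw [sub_add_cancel] at h1
      obtain ⟨k, hk⟩ := WRank.exists_nat_of_lt_arrow
        (h1.trans_le (hc.rank_le (m - 1) ⟨by simp, by simp; omega⟩))
      exact ⟨k, fun _ => hk⟩
    · exact ⟨0, fun h => absurd h hm⟩
  choose σ hσ using hnat
  have hlast := hc.piece (h - 1) ⟨by simp, by simp⟩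
  rw [PreWGraph.pieceOK_iff arrow_ne_zero] at hlast
  obtain ⟨N, hN⟩ := WRank.exists_nat_of_lt_arrow hlast.2.2.1
  refine ⟨σ, N, hc, hσ, fun m hm => ?_, fun m hm => ?_, hN⟩
  · have := (hanti m hm).1
    rw [hσ _ (by omega), hσ _ (by omega)] at this
    exact WRank.nat_lt_nat.1 this
  · have := (hanti m hm).2
    rwa [hσ _ (by omega)] at this

namespace ArrowData

variable {h : ℤ} {x : ℤ → X} {P : ℤ → WSeq X} {σ : ℤ → ℕ} {N : ℕ}

theorem sigma_le (D : ArrowData G h x P σ N) (j : ℤ) (i : ℕ) (hj : j + i < h) :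
    σ (j + i) + i ≤ σ j := by
  induction i with
  | zero => simp
  | succ i ih =>
    have h1 := ih (by push_cast at hj; omega)
    have h2 := D.anti (j + i) (by push_cast at hj; omega)
    push_cast
    rw [show j + ((i : ℤ) + 1) = j + i + 1 by ring]
    omega

theorem pieces (D : ArrowData G h x P σ N) {m : ℤ} (hm : m < h) :
    G.IsWalk (P m) ∧ (P m).Nontrivial ∧ (P m).rank < WRank.arrow ∧ G.LeftReach (x m) (P m) ∧
      G.RightReach (x (m + 1)) (P m) :=
  (PreWGraph.pieceOK_iff arrow_ne_zero).1 (D.core.piece m ⟨by simp, by simpa using hm⟩)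

theorem half (D : ArrowData G h x P σ N) {j : ℤ} (hj : j < h) :
    Half G none (fun m => x (m + j)) fun m => P (m + j) := by
  have h1 := (D.core.restrict (lo' := none) (hi' := some j) (by simp) (by simp)
    (by simpa using hj.le)).shift (-j)
  simp only [Option.map_none, Option.map_some, sub_neg_eq_add, add_neg_cancel] at h1
  refine ⟨h1, Or.inl rfl, fun m hm _ => ?_⟩
  have e : m + 1 + j = m + j + 1 := by ring
  simp only [e]
  rw [D.rank_eq _ (by omega), D.rank_eq _ (by omega)]
  exact ⟨WRank.nat_lt_nat.2 (D.anti _ (by omega)), D.piece_lt _ (by omega)⟩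

theorem leftKeeps_half (D : ArrowData G h x P σ N) {j : ℤ} (hj : j < h) :
    LeftKeeps G (.seq WRank.arrow none (some h) x P)
      (.seq WRank.arrow none (some 0) (fun m => x (m + j)) fun m => P (m + j)) :=
  leftKeeps_of_agree (D.half hj).isWalk 0 (-j) (fun m _ => by rw [neg_add_cancel_right])
    fun m _ => by rw [neg_add_cancel_right]

theorem piece_le (D : ArrowData G h x P σ N) {j m : ℤ} {n : ℕ} (hjm : j ≤ m) (hm : m < h)
    (hn : σ j ≤ n + 1) (hN : N ≤ n) : (P m).rank ≤ WRank.nat n := by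
  by_cases hmh : m = h - 1
  · rw [hmh, D.last]
    exact WRank.nat_le_nat.2 hN
  · obtain ⟨k, hk, hk'⟩ := WRank.exists_nat_of_lt_nat (D.piece_lt m (by omega))
    have := D.sigma_le j (m - j).toNat (by omega)
    rw [show j + ((m - j).toNat : ℤ) = m by omega] at this
    rw [hk']
    exact WRank.nat_le_nat.2 (by omega)

theorem exists_composite (D : ArrowData G h x P σ N) {j : ℤ} {n : ℕ} (hj : j < h)
    (hn : σ j ≤ n + 1) (hN : N ≤ n) :
    ∃ T, G.IsWalk T ∧ T.Nontrivial ∧ T.rank ≤ WRank.nat (n + 1) ∧ G.LeftReach (x j) T ∧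
      G.RightReach (x h) T ∧ ¬ (T.rank = WRank.nat (n + 1) ∧ T.LInf) ∧
      ¬ (T.rank = WRank.nat (n + 1) ∧ T.RInf) := by
  have := WGraph.exists_composite (G := G) (n := n) (x := x) (P := P) j (h - 1 - j).toNat
    fun m hm hm' => by
      obtain ⟨h1, h2, -, h4, h5⟩ := D.pieces (m := m) (by omega)
      exact ⟨h1, h2, D.piece_le hm (by omega) hn hN, h4, h5⟩
  rwa [show j + ((h - 1 - j).toNat : ℤ) + 1 = h by omega] at this

/-- The walk is cut at `x j`. The wtip needed there comes from the left, so the finitely many pieces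
on the right can be composed in any sufficiently large natural rank. -/
theorem flex_of_rightTip (D : ArrowData G h x P σ N) {j : ℤ} (hj : j < h)
    (ht : G.RightTip (x j) (P (j - 1))) : Flex G (.seq WRank.arrow none (some h) x P) (x h) := by
  obtain ⟨T, t1, t2, t3, t4, t5, -⟩ := D.exists_composite (n := max (σ j) N) hj (by omega)
    (by omega)
  obtain ⟨t, ht'⟩ := WRank.exists_nat_of_lt_arrow (t3.trans_lt (WRank.nat_lt_arrow _))
  exact ⟨none, _, _, T, t, D.half hj, Or.inr (by
    simp only [zero_add]
    rwa [show -1 + j = j - 1 by ring]), t1, t2, ht', by simpa using t4, t5, D.leftKeeps_half hj⟩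

theorem rank_of_leftTip (D : ArrowData G h x P σ N) {j : ℤ} (hj : j < h)
    (ht : G.LeftTip (x j) (P j)) : ∃ s, σ j = s + 1 ∧ (P j).rank = WRank.nat s := by
  obtain ⟨s, hs⟩ := WRank.exists_nat_of_lt_arrow (D.pieces hj).2.2.1
  have := WGraph.rank_of_leftTip ht
  rw [D.rank_eq _ hj, hs, WRank.next_nat] at this
  exact ⟨s, WRank.nat_injective this, hs⟩

theorem stiff_of_leftTip (D : ArrowData G h x P σ N)
    (ht : ∀ j < h, G.LeftTip (x j) (P j)) (hf : ∀ J, ∃ j ≤ J, ¬ (P j).RInf) :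
    Stiff G (.seq WRank.arrow none (some h) x P) (x h) := by
  intro n
  -- So far to the left, `σ j` exceeds `n + N + 2`. The rank of `P j`, which is `σ j - 1` by its
  -- left wtip, is then larger than `n` and large enough for composing `P j` with all later pieces
  -- without raising its rank.
  obtain ⟨j, hj, hjR⟩ := hf (h - 2 - (n + N + 2))
  have hjh : j < h := by omega
  obtain ⟨s, hs, hPs⟩ := D.rank_of_leftTip hjh (ht j hjh)
  have h1 := D.sigma_le j (h - 1 - j).toNat (by omega)
  have h2 := D.anti j (by omega)
  obtain ⟨s', rfl⟩ : ∃ s', s = s' + 1 := ⟨s - 1, by omega⟩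
  obtain ⟨T, t1, t2, t3, t4, t5, t6, t7⟩ := D.exists_composite (j := j + 1) (n := s') (by omega)
    (by omega) (by omega)
  obtain ⟨p1, p2, -, p4, p5⟩ := D.pieces hjh
  obtain ⟨M, hM1, hM2, hM3, hM4, hM5, hM6, -, -, hM9⟩ := composable_nat (G := G) (s' + 1) le_top
    (P j) T _ p1 t1 p2 t2 hPs.le t3 p5 t4 (fun h => hjR h.2) t6
  have hr : G.rank (x j) = WRank.nat (s' + 1 + 1) := by rw [D.rank_eq _ hjh, hs]
  refine ⟨_, _, M, s' + 1, by omega, D.half hjh, hM1, hM2, hM3, by simpa using hr, ?_,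
    fun h => t7 (hM9 h), hM5 _ t5, D.leftKeeps_half hjh⟩
  simpa using hM6 _ (hr ▸ WRank.nat_lt_nat.2 (Nat.lt_succ_self _)) (ht j hjh)

/-- If the pieces are eventually endless and traverse wtips in wnodes that embrace the next wnodes,
then the walk can be replaced by another one, whose wtip is in a different wnode. -/
theorem exists_detour (D : ArrowData G h x P σ N)
    (ht : ∀ j < h, G.LeftTip (x j) (P j)) {J : ℤ} (hJ : J + 1 < h) (hf : ∀ j ≤ J, (P j).RInf) :
    ∃ (V : WSeq X) (u : X), Flex G V (x h) ∧ G.rank u = ⊤ ∧ G.LeftTip u V ∧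
      Joinable G (.seq WRank.arrow none (some h) x P) V := by
  have hy : ∀ j, ∃ w, j ≤ J → G.Linked w (x (j + 1)) ∧ G.RightTip w (P j) := by
    intro j
    by_cases hj : j ≤ J
    · obtain ⟨w, h1, h2⟩ :=
        exists_rightTip_of_rightReach (D.pieces (m := j) (by omega)).2.2.2.2 (hf j hj)
      exact ⟨w, fun _ => ⟨h1, h2⟩⟩
    · exact ⟨x j, fun h => absurd h hj⟩
  choose w hw using hy
  have hwr : ∀ j ≤ J, G.rank (w j) = G.rank (x j) := fun j hj => by
    rw [rank_of_rightTip (hw j hj).2, WGraph.rank_of_leftTip (ht j (by omega))]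
  -- The same pieces are kept, but the wnodes `x (j + 1)` are replaced by the linked wnodes `w j`
  -- that contain the right wtips of the `P j`. The wtips at the nonterminal wnodes now come from
  -- the left, which makes the new walk flexible.
  have hH : Half G none (fun m => w (m + J)) fun m => P (m + J + 1) := by
    refine ⟨⟨by simp, fun m hm => ?_, fun m hm => ?_, fun m hm => ?_⟩, Or.inl rfl, fun m hm _ => ?_⟩
    · have := hm.2 0 rfl
      rw [hwr _ (by omega), D.rank_eq _ (by omega)]
      exact (WRank.nat_lt_arrow _).le
    · have := hm.2 0 rfl
      obtain ⟨p1, p2, p3, p4, p5⟩ := D.pieces (m := m + J + 1) (by omega)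
      rw [PreWGraph.pieceOK_iff arrow_ne_zero, show m + 1 + J = m + J + 1 by ring]
      exact ⟨p1, p2, p3, LeftReach.linked p4 (hw (m + J) (by omega)).1.symm,
        rightReach_of_rightTip (hw _ (by omega)).2⟩
    · have := hm.2 0 rfl
      refine fun _ => ⟨Or.inl ?_, fun h => absurd rfl h⟩
      rw [show m - 1 + J + 1 = m + J by ring]
      exact (hw _ (by omega)).2
    · have h1 := D.anti (m + J) (by omega)
      have h2 := D.piece_lt (m + J + 1) (by omega)
      rw [show m + 1 + J = m + J + 1 by ring, hwr _ (by omega), hwr _ (by omega),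
        D.rank_eq _ (by omega), D.rank_eq _ (by omega)]
      exact ⟨WRank.nat_lt_nat.2 h1, h2.trans (WRank.nat_lt_nat.2 h1)⟩
  obtain ⟨u, hu⟩ := exists_leftTip (G := G) (W := .seq WRank.arrow none (some 0) _ _)
    WRank.arrow_lt_top hH.isWalk trivial
  have hflex : G.RightTip (w (0 + J)) (P (-1 + J + 1)) := by
    rw [zero_add, show -1 + J + 1 = J by ring]
    exact (hw J le_rfl).2
  refine ⟨_, u, ?_, by rw [WGraph.rank_of_leftTip hu]; exact WRank.next_arrow, hu, ?_⟩
  · obtain ⟨T, t1, t2, t3, t4, t5, -⟩ := D.exists_composite (n := max (σ (J + 1)) N) hJ (by omega)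
      (by omega)
    obtain ⟨t, ht'⟩ := WRank.exists_nat_of_lt_arrow (t3.trans_lt (WRank.nat_lt_arrow _))
    refine ⟨none, _, _, T, t, hH, Or.inr hflex, t1, t2, ht', ?_, t5, fun _ => id, fun _ _ => id⟩
    simp only [zero_add]
    exact LeftReach.linked t4 (hw J le_rfl).1.symm
  -- The piece `P J` leads from `x J` to `w J`, thus joining the old half to the new one; it
  -- traverses the wtips needed at both ends.
  · obtain ⟨p1, p2, p3, p4, p5⟩ := D.pieces (m := J) (by omega)
    refine (Half.joinable (D.half (j := J) (by omega)) hH p1 p2 p3 (by simpa using p4) ?_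
      (Or.inr (by simpa using ht J (by omega))) (Or.inl (Or.inr hflex))).mono
        (D.leftKeeps_half (by omega)) ⟨fun _ => id, fun _ _ => id⟩
    simpa using rightReach_of_rightTip (hw J le_rfl).2

end ArrowData

/-- Each walk can be extended on its right, possibly after passing to another walk. -/
theorem exists_flex_or_stiff {W : WSeq X} {y : X} (hW : G.IsWalk W) (hn : W.Nontrivial)
    (hr : W.rank < ⊤) (hy : G.RightReach y W) (hinf : ¬ (W.rank = WRank.arrow ∧ W.RInf)) :
    (Flex G W y ∨ Stiff G W y) ∨
      ∃ (V : WSeq X) (u : X), Flex G V y ∧ G.rank u = ⊤ ∧ G.LeftTip u V ∧ Joinable G W V := by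
  rcases (WRank.le_arrow_of_lt_top hr).lt_or_eq with hr | hr
  · obtain ⟨n, hn'⟩ := WRank.exists_nat_of_lt_arrow hr
    exact Or.inl (Or.inl (flex_of_nat hW hn hn' hy))
  rcases W with b | ⟨r, lo, hi, x, P⟩
  · simp [PreWGraph.IsWalk] at hW
  obtain rfl : r = WRank.arrow := hr
  cases hi with
  | none => exact absurd ⟨rfl, trivial⟩ hinf
  | some h =>
    obtain rfl : lo = none := by
      obtain ⟨h1 | h1, -⟩ := (PreWGraph.isWalk_iff.1 hW).2 rfl
      · exact h1
      · simp at h1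
    obtain ⟨σ, N, D⟩ := exists_arrowData hW
    have hl : G.Linked (x h) y := hy
    have flex : ∀ {V : WSeq X}, Flex G V (x h) → Flex G V y := by
      rintro V ⟨lo, x', P', T, t, h1, h2, h3, h4, h5, h6, h7, h8⟩
      exact ⟨lo, x', P', T, t, h1, h2, h3, h4, h5, h6, RightReach.linked h7 hl, h8⟩
    by_cases ht : ∃ j < h, G.RightTip (x j) (P (j - 1))
    · obtain ⟨j, hj, ht⟩ := ht
      exact Or.inl (Or.inl (flex (D.flex_of_rightTip hj ht)))
    have ht' : ∀ j < h, G.LeftTip (x j) (P j) := fun j hj =>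
      ((D.core.node j ⟨by simp, by simpa using hj⟩ arrow_ne_zero).1).resolve_left
        fun h => ht ⟨j, hj, h⟩
    by_cases hf : ∀ J, ∃ j ≤ J, ¬ (P j).RInf
    · refine Or.inl (Or.inr fun n => ?_)
      obtain ⟨x', P', T, t, h0, h1, h2, h3, h4, h5, h6, h7, h8, h9⟩ := D.stiff_of_leftTip ht' hf n
      exact ⟨x', P', T, t, h0, h1, h2, h3, h4, h5, h6, h7, RightReach.linked h8 hl, h9⟩
    · push Not at hf
      obtain ⟨J, hJ⟩ := hf
      -- The minimum with `h - 2` ensures that the cut wnode `x (J + 1)` comes before `x h`.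
      obtain ⟨V, u, h1, h2⟩ := D.exists_detour ht' (J := min J (h - 2)) (by omega)
        fun j hj => hJ j (by omega)
      exact Or.inr ⟨V, u, flex h1, h2⟩

/-- A wtip of rank arrow `ω` at the junction lies in a wnode of rank `ω`, and `bridging_of_tip`
applies. Otherwise each side either is joinable directly or needs a detour through a wnode `u` or
`u'` of rank `ω`, and each detour adds one piece. The wtips in `u` and `u'` that the detour pieces
traverse make these wnodes admissible. -/
theorem bridging_top (G : WGraph X ⊤) : G.Bridging ⊤ := by
  intro a y y' c p q hp hq hl ha hy hy' hc
  have hr0 : (⊤ : WRank) ≠ 0 := by simp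
  obtain ⟨hp1, hp2, hp3, hp4, hp5⟩ := (PreWGraph.pieceOK_iff hr0).1 hp
  obtain ⟨hq1, hq2, hq3, hq4, hq5⟩ := (PreWGraph.pieceOK_iff hr0).1 hq
  by_cases hpi : p.rank = WRank.arrow ∧ p.RInf
  · obtain ⟨u, hu1, hu2⟩ := exists_rightTip_of_rightReach hp5 hpi.2
    refine bridging_of_tip hr0 hp hq hu1 (Linked.trans hu1 hl) ha hc ?_ (Or.inl hu2)
    rw [rank_of_rightTip hu2, hpi.1, WRank.next_arrow]
  by_cases hqi : q.rank = WRank.arrow ∧ q.LInf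
  · obtain ⟨u, hu1, hu2⟩ := exists_rightTip_of_rightReach hq4 hqi.2
    refine bridging_of_tip hr0 hp hq (Linked.trans hu1 hl.symm) hu1 ha hc ?_ (Or.inr hu2)
    rw [rank_of_leftTip hu2, hqi.1, WRank.next_arrow]
  have hqr : G.LeftReach c q.reverse := PreWGraph.leftReach_reverse.2 hq5
  have hR : ∀ {V M : WSeq X}, LeftKeeps G V M.reverse →
      (∀ z, G.LeftReach z V → G.RightReach z M) ∧
      ∀ u, G.rank u = ⊤ → G.LeftTip u V → G.RightTip u M := fun h =>
    ⟨fun z hz => PreWGraph.leftReach_reverse.1 (h.1 z hz),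
      fun u hu hz => PreWGraph.leftTip_reverse.1 (h.2 u hu hz)⟩
  have hqt : ∀ {M : WSeq X}, LeftKeeps G q.reverse M.reverse →
      ∀ u, G.rank u = ⊤ → G.RightTip u q → G.RightTip u M := fun h u hu hz =>
    (hR h).2 u hu (PreWGraph.leftTip_reverse.2 hz)
  have hpieceOK : ∀ {M : WSeq X} {v w : X}, G.IsWalk M → M.Nontrivial → M.rank < ⊤ →
      G.LeftReach v M → G.RightReach w M → G.PieceOK ⊤ v M w := fun h1 h2 h3 h4 h5 =>
    (PreWGraph.pieceOK_iff hr0).2 ⟨h1, h2, h3, h4, h5⟩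
  have key := exists_flex_or_stiff hp1 hp2 hp3 hp5 hpi
  have key' := exists_flex_or_stiff (y := y) hq1.reverse (WSeq.nontrivial_reverse.2 hq2)
    (by rwa [WSeq.rank_reverse])
    (PreWGraph.leftReach_reverse.1 (by
      rw [WSeq.reverse_reverse]
      exact LeftReach.linked hq4 hl.symm))
    (by rwa [WSeq.rank_reverse])
  rcases key with hF | ⟨V, u, hV, hur, hu, M, hM1, hM2, hM3, hM4, hM5⟩ <;>
    rcases key' with hF' | ⟨V', u', hV', hur', hu', M', hM1', hM2', hM3', hM4', hM5'⟩
  · obtain ⟨K, k1, k2, k3, k4, k5⟩ := joinable_of_flex_or_stiff hF hF'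
    exact bridging_of_composite hr0 k1 k2 k3 (k4.1 _ hp4) ((hR k5).1 _ hqr) ha hc k4.2 (hqt k5)
  · obtain ⟨K, k1, k2, k3, k4, k5⟩ := joinable_of_flex_or_stiff hF (Or.inl hV')
    have hKu := (hR k5).1 _ (leftReach_of_leftTip hu')
    have hMu := hM5'.2 _ hur' hu'
    obtain ⟨k, d, R, b1, b2, b3, b4, b5, b6, b7⟩ := bridging_of_tip hr0
      (hpieceOK k1 k2 k3 (k4.1 _ hp4) hKu)
      (hpieceOK hM1'.reverse (WSeq.nontrivial_reverse.2 hM2') (by rwa [WSeq.rank_reverse])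
        (leftReach_of_leftTip hMu) (PreWGraph.leftReach_reverse.1 (by
          rw [WSeq.reverse_reverse]; exact hM4'.1 _ hqr)))
      (PreWGraph.Linked.refl u') (PreWGraph.Linked.refl u') ha hc hur' (Or.inr hMu)
    exact ⟨k, d, R, b1, b2, b3, b4, b5, fun v hv hv' => b6 v hv (k4.2 v hv hv'),
      fun v hv hv' => b7 v hv (hqt (by rwa [WSeq.reverse_reverse]) v hv hv')⟩
  · obtain ⟨K, k1, k2, k3, k4, k5⟩ := joinable_of_flex_or_stiff (Or.inl hV) hF'
    have hKu := k4.1 _ (leftReach_of_leftTip hu)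
    have hMu := (hR hM5).2 _ hur hu
    obtain ⟨k, d, R, b1, b2, b3, b4, b5, b6, b7⟩ := bridging_of_tip hr0
      (hpieceOK hM1 hM2 hM3 (hM4.1 _ hp4) (rightReach_of_rightTip hMu))
      (hpieceOK k1 k2 k3 hKu ((hR k5).1 _ hqr))
      (PreWGraph.Linked.refl u) (PreWGraph.Linked.refl u) ha hc hur (Or.inl hMu)
    exact ⟨k, d, R, b1, b2, b3, b4, b5, fun v hv hv' => b6 v hv (hM4.2 v hv hv'),
      fun v hv hv' => b7 v hv (hqt k5 v hv hv')⟩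
  · obtain ⟨K, k1, k2, k3, k4, k5⟩ := joinable_of_flex_or_stiff (Or.inl hV) (Or.inl hV')
    have hKu := k4.1 _ (leftReach_of_leftTip hu)
    have hKu' := (hR k5).1 _ (leftReach_of_leftTip hu')
    have hMu := (hR hM5).2 _ hur hu
    have hMu' := hM5'.2 _ hur' hu'
    have s1 := PreWGraph.Core.single
      (hpieceOK hM1 hM2 hM3 (hM4.1 _ hp4) (rightReach_of_rightTip hMu)) le_top le_top 0
    have s2 := PreWGraph.Core.single (hpieceOK k1 k2 k3 hKu hKu') le_top le_top (0 + 1)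
    have s3 := PreWGraph.Core.single
      (hpieceOK hM1'.reverse (WSeq.nontrivial_reverse.2 hM2') (by rwa [WSeq.rank_reverse])
        (leftReach_of_leftTip hMu') (PreWGraph.leftReach_reverse.1 (by
          rw [WSeq.reverse_reverse]; exact hM4'.1 _ hqr))) le_top le_top (0 + 1 + 1)
    have s12 := s1.concat s2 (by simp) fun _ _ => ⟨Or.inl (by simpa using hMu), fun _ => by
      simpa using hur⟩
    have s123 := s12.concat s3 (by simp [glue]) fun _ _ => ⟨Or.inr (by simpa [glue] using hMu'),
      fun _ => by simpa [glue] using hur'⟩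
    refine ⟨3, _, _, by norm_num, le_rfl, s123, by simp [glue], by simp [glue],
      fun v hv hv' => ?_, fun v hv hv' => ?_⟩
    · simpa [glue] using hM4.2 v hv hv'
    · have := hqt (M := M'.reverse) (by rwa [WSeq.reverse_reverse]) v hv hv'
      simpa [glue] using this

/-- Bridging holds in all ranks other than arrow `ω`. -/
theorem bridging {ν : WRank} (G : WGraph X ν) {r : WRank} (hr : r ≤ ν) (hra : r ≠ WRank.arrow) :
    G.Bridging r := by
  rcases WRank.cases r with ⟨n, rfl⟩ | rfl | rfl
  · exact bridging_nat n hr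
  · exact absurd rfl hra
  · obtain rfl := top_le_iff.1 hr
    exact bridging_top G

end WGraph

/-! ### Lengths and distances -/

theorem WRank.tipExponent_eq {r : WRank} (hr : r ≠ WRank.arrow) :
    r.tipExponent = r.exponent + 1 := by
  rcases WRank.cases r with ⟨n, rfl⟩ | rfl | rfl
  · rfl
  · exact absurd rfl hr
  · rfl

theorem WRank.tipExponent_mono {r s : WRank} (h : r ≤ s) : r.tipExponent ≤ s.tipExponent := by
  rcases h.eq_or_lt with rfl | h
  · exact le_rfl
  · exact (tipExponent_strictMono h).le

namespace PreWGraph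

variable {X : Type u} {G : PreWGraph X}

/-- A two-ended walk is a finite natural sum of branches or of pieces of smaller rank, each shorter
than `ω ^ r.tipExponent`, and these ordinals are closed under natural sums. At infinite ends the
length is prescribed. -/
theorem length_le_and_lt {W : WSeq X} (hW : G.IsWalk W) :
    W.length ≤ Ordinal.omega0 ^ W.rank.tipExponent * 2 ∧
      (¬ W.LInf → ¬ W.RInf → W.length < Ordinal.omega0 ^ W.rank.tipExponent) := by
  induction W with
  | branch b => simp [IsWalk] at hW
  | seq r lo hi x P ih =>
    set t := Ordinal.omega0 ^ r.tipExponent with ht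
    have h12 : t ≤ t * 2 := Ordinal.le_mul_left t (by norm_num)
    have hlt : ∀ a b, lo = some a → hi = some b → (WSeq.seq r lo hi x P).length < t := by
      rintro a b rfl rfl
      simp only [WSeq.length]
      refine natSum_lt_omega0_opow fun i hi => ?_
      have hp := hW.core.piece (a + i) ⟨by simp, by simp; omega⟩
      by_cases h0 : r = 0
      · rw [PieceOK, if_pos h0] at hp
        rw [hp.1, WSeq.length]
        have : (0 : Ordinal.{0}) < r.tipExponent := by
          rw [h0, ← WRank.nat_zero, WRank.tipExponent_nat]
          simp
        exact Ordinal.one_lt_opow.2 ⟨Ordinal.one_lt_omega0, this.ne'⟩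
      · rw [pieceOK_iff h0] at hp
        refine (ih _ hp.1).1.trans_lt ?_
        exact_mod_cast Ordinal.opow_mul_lt_opow (Ordinal.natCast_lt_omega0 2)
          (WRank.tipExponent_strictMono hp.2.2.1)
    cases lo with
    | none =>
      refine ⟨?_, fun h => absurd trivial h⟩
      cases hi with
      | none => simp only [WSeq.length, WSeq.rank]; exact le_rfl
      | some b => simp only [WSeq.length, WSeq.rank]; exact h12
    | some a =>
      cases hi with
      | none =>
        refine ⟨?_, fun _ h => absurd trivial h⟩
        simp only [WSeq.length, WSeq.rank]
        exact h12
      | some b => exact ⟨(hlt a b rfl rfl).le.trans h12, fun _ _ => hlt a b rfl rfl⟩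

theorem le_length_of_rInf {W : WSeq X} (h : W.RInf) :
    Ordinal.omega0 ^ W.rank.tipExponent ≤ W.length := by
  rcases W with b | ⟨r, lo, hi, x, P⟩
  · exact h.elim
  · cases hi with
    | some b => exact h.elim
    | none =>
      cases lo <;> simp only [WSeq.length, WSeq.rank]
      · exact Ordinal.le_mul_left _ (by norm_num)
      · exact le_rfl

theorem le_length_of_lInf {W : WSeq X} (h : W.LInf) :
    Ordinal.omega0 ^ W.rank.tipExponent ≤ W.length := by
  rw [← WSeq.length_reverse, ← WSeq.rank_reverse]
  exact le_length_of_rInf h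

theorem PieceOK.length_le {r : WRank} {a b : X} {p : WSeq X} (h : G.PieceOK r a p b)
    (hr : r ≠ WRank.arrow) : p.length ≤ Ordinal.omega0 ^ r.exponent * 2 := by
  by_cases h0 : r = 0
  · rw [PieceOK, if_pos h0] at h
    rw [h.1, WSeq.length]
    calc (1 : Ordinal.{0}) ≤ Ordinal.omega0 ^ r.exponent :=
          Order.one_le_iff_pos.2 (Ordinal.opow_pos _ Ordinal.omega0_pos)
      _ ≤ _ := Ordinal.le_mul_left _ (by norm_num)
  · rw [pieceOK_iff h0] at h
    refine (length_le_and_lt h.1).1.trans ?_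
    gcongr
    · exact Ordinal.omega0_pos
    · exact WRank.tipExponent_le_exponent h.2.2.1 hr

theorem IsWalkBetween.reverse {x y : X} {W : WSeq X} (h : G.IsWalkBetween x y W) :
    G.IsWalkBetween y x W.reverse := by
  obtain ⟨hW, r, a, b, z, P, rfl, h1, h2⟩ := h
  refine ⟨hW.reverse, r, -b, -a, _, _, rfl, ?_, ?_⟩ <;> simpa

theorem wdist_le {x y : X} {W : WSeq X} (h : G.IsWalkBetween x y W) : G.wdist x y ≤ W.length :=
  csInf_le' ⟨W, h, rfl⟩

theorem exists_length_eq_wdist {x y : X} (h : ∃ W, G.IsWalkBetween x y W) :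
    ∃ W, G.IsWalkBetween x y W ∧ G.wdist x y = W.length := by
  obtain ⟨W, hW⟩ := h
  exact csInf_mem (s := {l | ∃ W, G.IsWalkBetween x y W ∧ l = W.length}) ⟨_, W, hW, rfl⟩

theorem wdist_comm (x y : X) : G.wdist x y = G.wdist y x := by
  unfold wdist
  congr 1
  ext l
  constructor <;> rintro ⟨W, h, rfl⟩ <;> exact ⟨W.reverse, h.reverse, W.length_reverse.symm⟩

end PreWGraph

/-! ### Replacing short walks by `ρ`-walks, and the triangle inequality up to `slack` -/

namespace WGraph

variable {X : Type u} {ν : WRank} {G : WGraph X ν}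

theorem omega0_opow_succ_le_length {ρ : WRank} (hρ : ρ ≠ WRank.arrow) {W : WSeq X}
    (hr : ρ ≤ W.rank) (h : W.RInf ∨ W.LInf) :
    Ordinal.omega0 ^ (ρ.exponent + 1) ≤ W.length := by
  have h1 : Ordinal.omega0 ^ (ρ.exponent + 1) ≤ Ordinal.omega0 ^ W.rank.tipExponent := by
    refine Ordinal.opow_le_opow_right Ordinal.omega0_pos ?_
    exact Order.add_one_le_of_lt (WRank.exponent_lt_tipExponent hr hρ)
  exact h1.trans (h.elim PreWGraph.le_length_of_rInf PreWGraph.le_length_of_lInf)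

/-- Walks of length less than `ω ^ (ρ + 1)` can be replaced by `ρ`-walks. -/
theorem exists_core_of_isWalkBetween {ρ : WRank} (hρ : ρ ≠ WRank.arrow)
    {x y : X} {W : WSeq X} (hx : G.rank x ≤ ρ) (hy : G.rank y ≤ ρ) (h : G.IsWalkBetween x y W)
    (hlen : W.length < Ordinal.omega0 ^ (ρ.exponent + 1)) :
    ∃ (a b : ℤ) (z : ℤ → X) (P : ℤ → WSeq X), G.Core ρ (some a) (some b) z P ∧
      G.Linked (z a) x ∧ G.Linked (z b) y ∧
      (WSeq.seq ρ (some a) (some b) z P).length ≤ W.length := by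
  have point : G.Linked x y → ∃ (a b : ℤ) (z : ℤ → X) (P : ℤ → WSeq X),
      G.Core ρ (some a) (some b) z P ∧ G.Linked (z a) x ∧ G.Linked (z b) y ∧
      (WSeq.seq ρ (some a) (some b) z P).length ≤ W.length := fun hxy =>
    ⟨0, 0, fun _ => x, fun _ => W, PreWGraph.Core.point hx 0 _ rfl _, PreWGraph.Linked.refl _, hxy,
      by simp [WSeq.length, natSum]⟩
  have single : ∀ {p : WSeq X}, G.IsWalk p → p.Nontrivial → p.rank < ρ → G.LeftReach x p →
      G.RightReach y p → ∃ (a b : ℤ) (z : ℤ → X) (P : ℤ → WSeq X),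
      G.Core ρ (some a) (some b) z P ∧ G.Linked (z a) x ∧ G.Linked (z b) y ∧
      (WSeq.seq ρ (some a) (some b) z P).length ≤ p.length := fun {p} h1 h2 h3 h4 h5 => by
    have h0 : ρ ≠ 0 := fun h => not_lt_zero (h ▸ h3)
    refine ⟨0, _, _, _, PreWGraph.Core.single
      ((PreWGraph.pieceOK_iff h0).2 ⟨h1, h2, h3, h4, h5⟩) hx hy 0, ?_, ?_, ?_⟩
    · simpa using PreWGraph.Linked.refl x
    · simpa using PreWGraph.Linked.refl y
    · simp [WSeq.length, natSum_one]
  induction W with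
  | branch b => simp [PreWGraph.IsWalkBetween, PreWGraph.IsWalk] at h
  | seq r lo hi z P ih =>
    obtain ⟨hW, r', a, b, z', P', he, hza, hzb⟩ := h
    cases he
    have hab := hW.core.le a rfl b rfl
    rcases eq_or_ne a b with rfl | hne
    · exact point (Linked.trans hza.symm hzb)
    have hab : a < b := lt_of_le_of_ne hab hne
    rcases lt_trichotomy r ρ with hr | rfl | hr
    · exact single hW ⟨a, by simpa [PieceIdx] using hab⟩ hr
        (by simpa [PreWGraph.LeftReach, WSeq.reverse, PreWGraph.RightReach] using hza) hzb
    · exact ⟨a, b, z, P, hW.core, hza, hzb, le_rfl⟩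
    have hr0 : r ≠ 0 := fun h => not_lt_zero (h ▸ hr)
    have hra : r ≠ WRank.arrow := fun h => by
      obtain ⟨h1 | h1, -⟩ := (PreWGraph.isWalk_iff.1 hW).2 h <;> simp at h1
    simp only [WSeq.length] at hlen ⊢
    have hpl : ∀ m, a ≤ m → m < b → (P m).length < Ordinal.omega0 ^ (ρ.exponent + 1) := by
      intro m h1 h2
      have := le_natSum (f := fun m => (P m).length) (a := a) (k := (b - a).toNat)
        (i := (m - a).toNat) (by omega)
      rw [show a + ((m - a).toNat : ℤ) = m by omega] at this
      exact this.trans_lt hlen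
    have hrank : ∀ {s : WRank}, s.next = r → ρ ≤ s := fun {s} hs => by
      by_contra! h
      exact absurd (WRank.next_le_of_lt h hρ) (not_le.2 (hs ▸ hr))
    -- A nonterminal wnode of rank `r > ρ` contains a wtip of rank at least `ρ` traversed by an
    -- adjacent piece. That piece alone has length at least `ω ^ (ρ + 1)`, so there are no
    -- nonterminal wnodes and `W` has just one piece.
    have hb : b = a + 1 := by
      by_contra hb
      obtain ⟨ht, hzr⟩ := hW.core.node (a + 1) ⟨by simp, by simp; omega⟩ hr0
      rw [add_sub_cancel_right] at ht
      have hzr := hzr hra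
      rcases ht with ht | ht
      · refine absurd (hpl a le_rfl (by omega)) (not_lt.2 ?_)
        exact omega0_opow_succ_le_length hρ (hrank (by rw [← rank_of_rightTip ht, hzr]))
          (Or.inl (rInf_of_rightTip ht))
      · refine absurd (hpl (a + 1) (by omega) (by omega)) (not_lt.2 ?_)
        exact omega0_opow_succ_le_length hρ (hrank (by rw [← rank_of_leftTip ht, hzr]))
          (Or.inr (rInf_of_rightTip ht))
    subst hb
    obtain ⟨p1, p2, p3, p4, p5⟩ := (PreWGraph.pieceOK_iff hr0).1
      (hW.core.piece a ⟨by simp, by simp⟩)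
    have hlp := hpl a le_rfl (by omega)
    have e : natSum (fun m => (P m).length) a (a + 1 - a).toNat = (P a).length := by
      rw [show (a + 1 - a).toNat = 1 by omega, natSum_one]
    simp only [e] at point ⊢
    have p4 : G.LeftReach x (P a) := LeftReach.linked p4 hza
    have p5 : G.RightReach y (P a) := RightReach.linked p5 hzb
    rcases lt_or_ge (P a).rank ρ with hpr | hpr
    · exact single p1 p2 hpr p4 p5
    · have hR : ¬ (P a).RInf := fun h =>
        absurd hlp (not_lt.2 (omega0_opow_succ_le_length hρ hpr (Or.inl h)))
      have hL : ¬ (P a).LInf := fun h =>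
        absurd hlp (not_lt.2 (omega0_opow_succ_le_length hρ hpr (Or.inr h)))
      have hbet : G.IsWalkBetween x y (P a) := by
        refine ⟨p1, ?_⟩
        rcases hPa : P a with c | ⟨r1, lo1, hi1, z1, P1⟩
        · simp [hPa, PreWGraph.IsWalk] at p1
        · rw [hPa] at hR hL p4 p5
          cases lo1 with
          | none => exact absurd trivial hL
          | some a1 =>
            cases hi1 with
            | none => exact absurd trivial hR
            | some b1 =>
              exact ⟨r1, a1, b1, z1, P1, rfl, by
                simpa [PreWGraph.LeftReach, WSeq.reverse, PreWGraph.RightReach] using p4, p5⟩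
      -- `point` refers to the length of the walk and is therefore carried through the induction;
      -- `e` equates the lengths of the walk and its only piece.
      refine ih a hbet hlp fun hxy => ?_
      obtain ⟨a1, b1, z1, P1, h1, h2, h3, h4⟩ := point hxy
      exact ⟨a1, b1, z1, P1, h1, h2, h3, h4.trans (by rw [WSeq.length]; exact e.le)⟩

/-- An upper bound of the lengths of `ρ`-walks with at most three pieces. -/
noncomputable def slack (ρ : WRank) : Ordinal.{0} :=
  natSum (fun _ => Ordinal.omega0 ^ ρ.exponent * 2) 0 3

theorem slack_lt (ρ : WRank) : slack ρ < Ordinal.omega0 ^ (ρ.exponent + 1) :=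
  natSum_lt_omega0_opow fun _ _ => by
    exact_mod_cast Ordinal.opow_mul_lt_opow (Ordinal.natCast_lt_omega0 2)
      (Order.lt_add_one_iff.2 le_rfl)

/-- Shortest walks are replaced by `ρ`-walks and spliced. The untouched pieces contribute at most
the two distances, and the at most three bridging pieces contribute at most `slack ρ`. -/
theorem wdist_triangle {ρ : WRank} (hρν : ρ ≤ ν) (hρ : ρ ≠ WRank.arrow) {x y z : X}
    (hx : G.rank x ≤ ρ) (hy : G.rank y ≤ ρ) (hz : G.rank z ≤ ρ)
    (hxy : ∃ W, G.IsWalkBetween x y W) (hyz : ∃ W, G.IsWalkBetween y z W)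
    (hxy' : G.wdist x y < Ordinal.omega0 ^ (ρ.exponent + 1))
    (hyz' : G.wdist y z < Ordinal.omega0 ^ (ρ.exponent + 1)) :
    G.wdist x z ≤ natAdd (natAdd (G.wdist x y) (G.wdist y z)) (slack ρ) := by
  obtain ⟨W, hW, hWl⟩ := PreWGraph.exists_length_eq_wdist hxy
  obtain ⟨V, hV, hVl⟩ := PreWGraph.exists_length_eq_wdist hyz
  rw [hWl] at hxy' ⊢
  rw [hVl] at hyz' ⊢
  obtain ⟨a, b, w, P, hc, hwa, hwb, hlen⟩ := exists_core_of_isWalkBetween hρ hx hy hW hxy'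
  obtain ⟨a', b', w', P', hc', hwa', hwb', hlen'⟩ := exists_core_of_isWalkBetween hρ hy hz hV hyz'
  have hl : G.Linked (w b) (w' a') := Linked.trans hwb hwa'.symm
  rcases (hc.le a rfl b rfl).eq_or_lt with rfl | hab
  · refine (PreWGraph.wdist_le ⟨hc'.isWalk hρ, ρ, a', b', w', P', rfl, ?_, hwb'⟩).trans ?_
    · exact Linked.trans hl.symm hwa
    · exact hlen'.trans ((le_natAdd_left _ _).trans (le_natAdd_right _ _))
  rcases (hc'.le a' rfl b' rfl).eq_or_lt with rfl | hab'
  · refine (PreWGraph.wdist_le ⟨hc.isWalk hρ, ρ, a, b, w, P, rfl, hwa, ?_⟩).trans ?_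
    · exact Linked.trans hl hwb'
    · exact hlen.trans ((le_natAdd_right _ _).trans (le_natAdd_right _ _))
  obtain ⟨k, s, v, Q, hk1, hk3, hs, hM, hv, hQ, hv', hQ'⟩ := (bridging G hρν hρ).splice hρ hc hc'
    ⟨by simp; omega, by simp⟩ ⟨by simp, by simpa using hab'⟩ hl
  simp only [Option.map_some] at hM
  refine (PreWGraph.wdist_le ⟨hM.isWalk hρ, ρ, a, b' + s, v, Q, rfl, ?_, ?_⟩).trans ?_
  · rwa [← hv a (by omega)]
  · rwa [← hv' b' (by omega)]
  simp only [WSeq.length] at hlen hlen' ⊢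
  obtain ⟨n₁, hn₁⟩ : ∃ n : ℕ, b - 1 - a = n := ⟨(b - 1 - a).toNat, by omega⟩
  obtain ⟨n₂, hn₂⟩ : ∃ n : ℕ, b' - (a' + 1) = n := ⟨(b' - (a' + 1)).toNat, by omega⟩
  obtain ⟨j, rfl⟩ : ∃ j : ℕ, k = j := ⟨k.toNat, by omega⟩
  have e1 : (b - a).toNat = n₁ + 1 := by omega
  have e2 : (b' - a').toNat = 1 + n₂ := by omega
  have e3 : (b' + s - a).toNat = n₁ + j + n₂ := by omega
  rw [e1, natSum_add] at hlen
  rw [e2, natSum_add] at hlen'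
  rw [e3, natSum_add, natSum_add]
  have l1 : natSum (fun m => (Q m).length) a n₁ ≤ W.length := by
    refine le_trans (le_of_eq ?_) ((le_natAdd_right _ _).trans hlen)
    exact natSum_congr fun i hi => by rw [hQ _ (by omega)]
  have l2 : natSum (fun m => (Q m).length) (a + (n₁ + j : ℕ)) n₂ ≤ V.length := by
    refine le_trans (le_of_eq ?_) ((le_natAdd_left _ _).trans hlen')
    refine natSum_congr fun i hi => ?_
    rw [hQ' _ (by push_cast; omega)]
    congr 2
    push_cast
    omega
  have l3 : natSum (fun m => (Q m).length) (a + n₁) j ≤ slack ρ := by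
    have h1 : natSum (fun m => (Q m).length) (a + n₁) j ≤
        natSum (fun _ => Ordinal.omega0 ^ ρ.exponent * 2) 0 j := by
      refine natSum_le_natSum fun i hi => ?_
      exact (hM.piece _ ⟨by simp; omega, by simp; omega⟩).length_le hρ
    refine h1.trans ?_
    rw [slack, show 3 = j + (3 - j) by omega, natSum_add]
    exact le_natAdd_right _ _
  calc _ ≤ natAdd (natAdd W.length (slack ρ)) V.length :=
        natAdd_le_natAdd (natAdd_le_natAdd l1 l3) l2
    _ = _ := by rw [natAdd_assoc, natAdd_comm (slack ρ), ← natAdd_assoc]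

theorem wdist_lt_of_wConnectedAt {ρ : WRank} (hρ : ρ ≠ WRank.arrow) {x y : X}
    (h : G.WConnectedAt ρ x y) : G.wdist x y < Ordinal.omega0 ^ (ρ.exponent + 1) := by
  obtain ⟨W, hW, hr⟩ := h
  refine (PreWGraph.wdist_le hW).trans_lt ?_
  obtain ⟨hW, r, a, b, z, P, rfl, -⟩ := hW
  refine ((PreWGraph.length_le_and_lt hW).2 id id).trans_le ?_
  rw [← WRank.tipExponent_eq hρ]
  exact Ordinal.opow_le_opow_right Ordinal.omega0_pos (WRank.tipExponent_mono hr)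

end WGraph

/-! ### Galaxies -/

namespace WGraph

variable {X : Type u} {ν : WRank} {G : WGraph X ν} {F : Ultrafilter ℕ} {S : Set X}

theorem Hypernode.exists_rep (x : G.Hypernode F S) :
    ∃ f : ℕ → G.NodesOfRank S x.1, x.2 = (f : Germ (F : Filter ℕ) _) := by
  obtain ⟨f, hf⟩ := Quot.exists_rep x.2
  exact ⟨f, hf.symm⟩

/-- A sequence of wnodes that represents the hypernode. -/
noncomputable def Hypernode.pts (x : G.Hypernode F S) (n : ℕ) : X := (x.exists_rep.choose n).1

theorem Hypernode.pts_mem (x : G.Hypernode F S) (n : ℕ) : x.pts n ∈ S :=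
  (x.exists_rep.choose n).2.1

theorem hyperdist_eq (x y : G.Hypernode F S) : G.hyperdist x y =
    ((fun n => G.wdist (x.pts n) (y.pts n) : ℕ → Ordinal.{0}) : Germ (F : Filter ℕ) _) := by
  have key : ∀ (a : Germ (F : Filter ℕ) (G.NodesOfRank S x.1))
      (b : Germ (F : Filter ℕ) (G.NodesOfRank S y.1)) (f : ℕ → G.NodesOfRank S x.1)
      (g : ℕ → G.NodesOfRank S y.1), a = f → b = g →
      Germ.map₂ (fun x y => G.wdist x.1 y.1) a b =
        ((fun n => G.wdist (f n).1 (g n).1 : ℕ → Ordinal.{0}) : Germ (F : Filter ℕ) _) := by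
    rintro _ _ f g rfl rfl
    rfl
  exact key _ _ _ _ x.exists_rep.choose_spec y.exists_rep.choose_spec

/-- The multiples `ω ^ ρ * μ` are cofinal in `ω ^ (ρ + 1)`. In this form bounds combine by
`natAdd_lt_omega0_opow`, without keeping track of coefficients. -/
theorem limitedlyDistant_iff {ρ : WRank} {x y : G.Hypernode F S} :
    G.LimitedlyDistant ρ x y ↔ ∃ c < Ordinal.omega0 ^ (ρ.exponent + 1),
      ∀ᶠ n in (F : Filter ℕ), G.wdist (x.pts n) (y.pts n) ≤ c := by
  unfold LimitedlyDistant
  rw [hyperdist_eq]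
  constructor
  · rintro ⟨μ, h⟩
    exact ⟨_, Ordinal.opow_mul_lt_opow (Ordinal.natCast_lt_omega0 μ)
      (Order.lt_add_one_iff.2 le_rfl), Germ.coe_le.1 h⟩
  · rintro ⟨c, hc, h⟩
    rw [← Order.succ_eq_add_one, Ordinal.lt_omega0_opow_succ] at hc
    obtain ⟨μ, hμ⟩ := hc
    exact ⟨μ, Germ.coe_le.2 (h.mono fun n hn => hn.trans hμ.le)⟩

theorem map₂_natAdd_le_iff {ρ : WRank} {x y z : G.Hypernode F S} :
    (∀ m : ℕ, Germ.map₂ natAdd (G.hyperdist y x) (unitMul F ρ m) ≤ G.hyperdist z x) ↔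
      ∀ c < Ordinal.omega0 ^ (ρ.exponent + 1), ∀ᶠ n in (F : Filter ℕ),
        natAdd (G.wdist (y.pts n) (x.pts n)) c ≤ G.wdist (z.pts n) (x.pts n) := by
  rw [hyperdist_eq, hyperdist_eq]
  constructor
  · intro h c hc
    rw [← Order.succ_eq_add_one, Ordinal.lt_omega0_opow_succ] at hc
    obtain ⟨m, hm⟩ := hc
    have := Germ.coe_le.1 (h m)
    exact this.mono fun n hn => (natAdd_le_natAdd le_rfl hm.le).trans hn
  · intro h m
    exact Germ.coe_le.2 (h _ (Ordinal.opow_mul_lt_opow (Ordinal.natCast_lt_omega0 m)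
      (Order.lt_add_one_iff.2 le_rfl)))

theorem LimitedlyDistant.symm {ρ : WRank} {x y : G.Hypernode F S}
    (h : G.LimitedlyDistant ρ x y) : G.LimitedlyDistant ρ y x := by
  rw [limitedlyDistant_iff] at h ⊢
  obtain ⟨c, hc, h⟩ := h
  exact ⟨c, hc, h.mono fun n hn => by rwa [PreWGraph.wdist_comm]⟩

section

variable (hG : G.WConnected) {ρ : WRank} (hρν : ρ ≤ ν) (hρ : ρ ≠ WRank.arrow)
  (hS : G.IsWSection ρ S)

include hG hρν hρ hS

theorem IsWSection.wdist_triangle {x y z : X} (hx : x ∈ S) (hy : y ∈ S) (hz : z ∈ S) :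
    G.wdist x z ≤ natAdd (natAdd (G.wdist x y) (G.wdist y z)) (slack ρ) :=
  WGraph.wdist_triangle hρν hρ (hS.1.1 x hx) (hS.1.1 y hy) (hS.1.1 z hz) (hG x y) (hG y z)
    (wdist_lt_of_wConnectedAt hρ (hS.1.2 x hx y hy))
    (wdist_lt_of_wConnectedAt hρ (hS.1.2 y hy z hz))

theorem LimitedlyDistant.trans {x y z : G.Hypernode F S} (h1 : G.LimitedlyDistant ρ x y)
    (h2 : G.LimitedlyDistant ρ y z) : G.LimitedlyDistant ρ x z := by
  rw [limitedlyDistant_iff] at *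
  obtain ⟨c, hc, h1⟩ := h1
  obtain ⟨d, hd, h2⟩ := h2
  refine ⟨natAdd (natAdd c d) (slack ρ), natAdd_lt_omega0_opow _ _
    (natAdd_lt_omega0_opow _ _ hc _ hd) _ (slack_lt ρ), ?_⟩
  filter_upwards [h1, h2] with n hn1 hn2
  exact (IsWSection.wdist_triangle hG hρν hρ hS (x.pts_mem n) (y.pts_mem n) (z.pts_mem n)).trans
    (natAdd_le_natAdd (natAdd_le_natAdd hn1 hn2) le_rfl)

theorem limitedlyDistant_of_mem_galaxy {Γ : G.Galaxy F S ρ} {y z : G.Hypernode F S}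
    (hy : y ∈ Γ.1.hypernodes) (hz : z ∈ Γ.1.hypernodes) : G.LimitedlyDistant ρ y z := by
  obtain ⟨Γ, x, rfl⟩ := Γ
  exact LimitedlyDistant.trans hG hρν hρ hS (LimitedlyDistant.symm hy) hz

theorem limitedlyDistant_of_mem_principalGalaxy {y z : G.Hypernode F S}
    (hy : y ∈ (G.principalGalaxy F S ρ).hypernodes)
    (hz : z ∈ (G.principalGalaxy F S ρ).hypernodes) : G.LimitedlyDistant ρ y z := by
  obtain ⟨s, hs⟩ := hy
  obtain ⟨t, ht⟩ := hz
  have hst : G.LimitedlyDistant (F := F) ρ (G.standard s) (G.standard t) := by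
    have h := wdist_lt_of_wConnectedAt hρ (hS.1.2 s s.2 t t.2)
    rw [← Order.succ_eq_add_one, Ordinal.lt_omega0_opow_succ] at h
    obtain ⟨μ, hμ⟩ := h
    exact ⟨μ, Germ.coe_le.2 (Eventually.of_forall fun _ => hμ.le)⟩
  exact LimitedlyDistant.trans hG hρν hρ hS (LimitedlyDistant.symm hs)
    (LimitedlyDistant.trans hG hρν hρ hS hst ht)

theorem not_closer_self (Γ : G.Galaxy F S ρ) : ¬ G.Closer Γ Γ := by
  rintro ⟨y, hy, z, hz, x, -, -, -, -, h⟩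
  rw [map₂_natAdd_le_iff] at h
  have hzy := limitedlyDistant_of_mem_galaxy hG hρν hρ hS hz hy
  rw [limitedlyDistant_iff] at hzy
  obtain ⟨c, hc, hzy⟩ := hzy
  set b := natAdd c (slack ρ) with hb
  have hb' : b < Ordinal.omega0 ^ (ρ.exponent + 1) := natAdd_lt_omega0_opow _ _ hc _ (slack_lt ρ)
  have h1 : (1 : Ordinal.{0}) < Ordinal.omega0 ^ (ρ.exponent + 1) :=
    Ordinal.one_lt_opow.2 ⟨Ordinal.one_lt_omega0, (Order.lt_add_one_iff.2 zero_le).ne'⟩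
  -- The distances of `y` and `z` to `x` differ by at most `b`, so a demanded gap of `b ⊕ 1` is
  -- contradictory after cancelling `d (y, x)`.
  obtain ⟨n, hn1, hn2⟩ := (hzy.and (h (natAdd b 1) (natAdd_lt_omega0_opow _ _ hb' _ h1))).exists
  have h2 := hn2.trans
    (IsWSection.wdist_triangle hG hρν hρ hS (z.pts_mem n) (y.pts_mem n) (x.pts_mem n))
  have h3 := h2.trans (natAdd_le_natAdd (natAdd_le_natAdd hn1 le_rfl) le_rfl)
  rw [natAdd_comm c, natAdd_assoc (G.wdist (y.pts n) (x.pts n)) c, ← hb,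
    natAdd_le_natAdd_iff_left] at h3
  have h4 : natAdd b 0 < natAdd b 1 := natAdd_lt_natAdd_left zero_lt_one b
  rw [natAdd_zero] at h4
  exact h3.not_gt h4

theorem Closer.trans {Γa Γb Γc : G.Galaxy F S ρ} (hab : G.Closer Γa Γb) (hbc : G.Closer Γb Γc) :
    G.Closer Γa Γc := by
  obtain ⟨y, hy, z, hz, x, hx, hxr, hyr, -, h⟩ := hab
  obtain ⟨z', hz', w, hw, x', hx', -, -, hwr, h'⟩ := hbc
  refine ⟨y, hy, w, hw, x, hx, hxr, hyr, hwr, ?_⟩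
  rw [map₂_natAdd_le_iff] at h h' ⊢
  intro c hc
  have hxx := limitedlyDistant_of_mem_principalGalaxy hG hρν hρ hS hx hx'
  have hzz := limitedlyDistant_of_mem_galaxy hG hρν hρ hS hz hz'
  rw [limitedlyDistant_iff] at hxx hzz
  obtain ⟨p, hp, hxx⟩ := hxx
  obtain ⟨q, hq, hzz⟩ := hzz
  set s := slack ρ with hs
  have hs' : s < Ordinal.omega0 ^ (ρ.exponent + 1) := slack_lt ρ
  have hps := natAdd_lt_omega0_opow _ _ hp _ hs'
  have hqs := natAdd_lt_omega0_opow _ _ hq _ hs'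
  -- The gap demanded from `h'` consists of `p ⊕ s` for passing from `x'` to `x` in `d (z', x')`, `q
  -- ⊕ s` for passing from `z'` to `z`, another `p ⊕ s` for passing from `x'` to `x` in `d (w, x')`,
  -- and the gap `c` to be proved. From `h` only `d (y, x) ≤ d (z, x)` is used.
  have hk := natAdd_lt_omega0_opow _ _ (natAdd_lt_omega0_opow _ _ hps _ hqs) _
    (natAdd_lt_omega0_opow _ _ hps _ hc)
  filter_upwards [hxx, hzz, h 0 (Ordinal.opow_pos _ Ordinal.omega0_pos), h' _ hk]
    with n h1 h2 h3 h4
  rw [natAdd_zero] at h3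
  have t1 := IsWSection.wdist_triangle hG hρν hρ hS (z.pts_mem n) (z'.pts_mem n) (x.pts_mem n)
  have t2 := IsWSection.wdist_triangle hG hρν hρ hS (z'.pts_mem n) (x'.pts_mem n) (x.pts_mem n)
  have t3 := IsWSection.wdist_triangle hG hρν hρ hS (w.pts_mem n) (x.pts_mem n) (x'.pts_mem n)
  rw [PreWGraph.wdist_comm (x'.pts n)] at t2
  rw [← hs] at t1 t2 t3
  -- Ordinals have no subtraction, so the error in comparing `d (w, x')` with `d (w, x)` is added to
  -- both sides and cancelled.
  rw [← natAdd_le_natAdd_iff_left (a := natAdd p s)]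
  calc natAdd (natAdd p s) (natAdd (G.wdist (y.pts n) (x.pts n)) c)
      ≤ natAdd (natAdd p s) (natAdd (natAdd (natAdd q
          (natAdd (natAdd (G.wdist (z'.pts n) (x'.pts n)) p) s)) s) c) := by
        refine natAdd_le_natAdd le_rfl (natAdd_le_natAdd (h3.trans (t1.trans ?_)) le_rfl)
        refine natAdd_le_natAdd (natAdd_le_natAdd h2 (t2.trans ?_)) le_rfl
        exact natAdd_le_natAdd (natAdd_le_natAdd le_rfl h1) le_rfl
    _ = natAdd (G.wdist (z'.pts n) (x'.pts n))
          (natAdd (natAdd (natAdd p s) (natAdd q s)) (natAdd (natAdd p s) c)) := by ac_rfl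
    _ ≤ _ := h4
    _ ≤ natAdd (natAdd (G.wdist (w.pts n) (x.pts n)) p) s :=
        t3.trans (natAdd_le_natAdd (natAdd_le_natAdd le_rfl h1) le_rfl)
    _ = _ := by ac_rfl

end

end WGraph

theorem theorem5p2 {X : Type u} {ν : WRank} (G : WGraph X ν) (hG : G.WConnected)
    (F : Ultrafilter ℕ) (hF : (F : Filter ℕ) ≤ Filter.cofinite)
    (ρ : WRank) (hρν : ρ ≤ ν) (hρ : ρ ≠ WRank.arrow)
    (S : Set X) (hS : G.IsWSection ρ S)
    (hv : ∃ v : G.Hypernode F S, v ∉ (G.principalGalaxy F S ρ).hypernodes) :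
    IsStrictOrder (G.Galaxy F S ρ) (fun Γa Γb => G.Closer Γa Γb) ∧
    IsPartialOrder (G.Galaxy F S ρ) (fun Γa Γb => Γa = Γb ∨ G.Closer Γa Γb) := by
  have irr := WGraph.not_closer_self (F := F) hG hρν hρ hS
  have tr := fun {a b c} => WGraph.Closer.trans (F := F) hG hρν hρ hS (Γa := a) (Γb := b) (Γc := c)
  refine ⟨{ irrefl := irr, trans := fun _ _ _ => tr },
    { refl := fun _ => Or.inl rfl, trans := ?_, antisymm := ?_ }⟩
  · rintro a b c (rfl | hab) (rfl | hbc)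
    · exact Or.inl rfl
    · exact Or.inr hbc
    · exact Or.inr hab
    · exact Or.inr (tr hab hbc)
  · rintro a b (rfl | hab) (h | hba)
    · rfl
    · rfl
    · exact h.symm
    · exact absurd (tr hab hba) (irr a)
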